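/- Let $A,B$ be finite-dimensional quantum systems, let $\rho_{AB}$ be a density matrix (positive semi-definite, trace one) on $AB$ and $\rho_B=\operatorname{tr}_A\rho_{AB}$. Logarithms are to base $2$, and powers and logarithms of positive semi-definite matrices are taken on the support. For a density matrix $\rho$ put $$H_\gamma(\rho)=\tfrac{1}{1-\gamma}\log\operatorname{tr}\rho^\gamma\quad(\gamma>0,\ \gamma\ne 1),\qquad H_1(\rho)=-\operatorname{tr}(\rho\log\rho),\qquad H_0(\rho)=\log\operatorname{rank}\rho .$$ For $\alpha\in(0,1)\cup(1,\infty)$ and positive semi-definite $\sigma$ let $$D_\alpha(\rho\|\sigma)=\tfrac{1}{\alpha-1}\log\operatorname{tr}\Big[\big(\sigma^{\frac{1-\alpha}{2\alpha}}\rho\,\sigma^{\frac{1-\alpha}{2\alpha}}\big)^{\alpha}\Big]$$ if $\rho\sigma\neq 0$ and ($\alpha<1$ or $\ker\sigma\subseteq\ker\rho$), and $D_\alpha(\rho\|\sigma)=\infty$ otherwise; let $D_1(\rho\|\sigma)=\operatorname{tr}[\rho(\log\rho-\log\sigma)]$ if $\ker\sigma\subseteq\ker\rho$ and $D_1(\rho\|\sigma)=\infty$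 otherwise. Put $$H^\uparrow_\beta(A|B)_\rho=-\inf_{\sigma_B}D_\beta(\rho_{AB}\|\mathrm{id}_A\otimes\sigma_B),$$ the infimum being over all density matrices $\sigma_B$ on $B$. **Theorem.** Let $\alpha,\beta,\gamma\in\mathbb R$ with $\alpha,\beta\ge\frac12$, $\gamma\ge 0$ and $$\alpha\beta\gamma-2\beta\gamma-\alpha+\beta+\gamma=0$$ (if none of the three equals $1$, this is the relation $\alpha'=\beta'+\gamma'$, where $x'=\frac{x}{x-1}$); if $\beta=\gamma=1$, assume moreover that $\alpha=1$. Read $\frac1\gamma=+\infty$ if $\gamma=0$. If $\frac1\beta+\frac1\gamma\le 2$ then $$H_\alpha(\rho_{AB})\ \ge\ H^\uparrow_\beta(A|B)_\rho+H_\gamma(\rho_B),$$ and if $\frac1\beta+\frac1\gamma\ge 2$ then $$H_\alpha(\rho_{AB})\ \le\ H^\uparrow_\beta(A|B)_\rho+H_\gamma(\rho_B).$$ -/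

import Mathlib

open scoped Kronecker ComplexOrder

/-- Density matrices: positive semi-definite complex matrices of trace one. -/
structure IsDensityMatrix {n : Type*} [Fintype n] (ρ : Matrix n n ℂ) : Prop where
  posSemidef : ρ.PosSemidef
  trace_eq_one : ρ.trace = 1

/-- The partial trace over the first tensor factor, `tr_A (K ⊗ L) = tr(K) L`. -/
def partialTraceLeft {a b : Type*} [Fintype a] (ρ : Matrix (a × b) (a × b) ℂ) : Matrix b b ℂ :=
  Matrix.of fun i j => ∑ k : a, ρ (k, i) (k, j)

/-- The power `M ^ s` of a positive semi-definite matrix, through the spectral decomposition.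
For `s ≠ 0` the eigenvalue `0` is sent to `0` (in Mathlib `0 ^ s = 0` for all real `s ≠ 0`), so
negative powers are powers of the pseudo-inverse. It is only used with `s ≠ 0`. -/
noncomputable def matrixPow {n : Type*} [Fintype n] [DecidableEq n]
    (M : Matrix n n ℂ) (s : ℝ) : Matrix n n ℂ :=
  cfc (fun x : ℝ => x ^ s) M

/-- The base two logarithm of a positive semi-definite matrix, through the spectral decomposition;
the kernel of the matrix is sent to zero. -/
noncomputable def matrixLog {n : Type*} [Fintype n] [DecidableEq n]
    (M : Matrix n n ℂ) : Matrix n n ℂ :=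
  cfc (fun x : ℝ => Real.logb 2 x) M

/-- The quantum Rényi entropy `H_α(ρ)` of order `α ≥ 0`, in bits:
`H_0(ρ)` is the logarithm of the dimension of the support, `H_1(ρ) = - tr (ρ log ρ)` is the
von Neumann entropy, and `H_α(ρ) = (1 - α)⁻¹ log tr (ρ ^ α)` for all other `α`. -/
noncomputable def renyiEntropy {n : Type*} [Fintype n] [DecidableEq n]
    (α : ℝ) (ρ : Matrix n n ℂ) : ℝ :=
  if α = 0 then Real.logb 2 (ρ.rank : ℝ)
  else if α = 1 then -(ρ * matrixLog ρ).trace.re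
  else 1 / (1 - α) * Real.logb 2 (matrixPow ρ α).trace.re

/-- `σ` dominates `ρ`, written `σ ≫ ρ`: the kernel of `σ` is contained in the kernel of `ρ`. -/
def Dominates {n : Type*} [Fintype n] (σ ρ : Matrix n n ℂ) : Prop :=
  ∀ v : n → ℂ, σ.mulVec v = 0 → ρ.mulVec v = 0

open Classical in
/-- The sandwiched Rényi divergence `D_α(ρ‖σ)` of order `α > 0`, in bits, with values in
`(-∞, ∞]`; order one is the quantum relative entropy `tr (ρ (log ρ - log σ))`.
For positive semi-definite matrices `ρ * σ = 0` says that the supports are orthogonal. -/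
noncomputable def renyiDivergence {n : Type*} [Fintype n] [DecidableEq n]
    (α : ℝ) (ρ σ : Matrix n n ℂ) : EReal :=
  if α = 1 then
    if Dominates σ ρ then (((ρ * (matrixLog ρ - matrixLog σ)).trace.re : ℝ) : EReal) else ⊤
  else if ρ * σ ≠ 0 ∧ (Dominates σ ρ ∨ α < 1) then
    ((1 / (α - 1) * Real.logb 2 (matrixPow
      (matrixPow σ ((1 - α) / (2 * α)) * ρ * matrixPow σ ((1 - α) / (2 * α))) α).trace.re : ℝ) :
        EReal)
  else ⊤

/-- The Rényi conditional entropy `H^↑_α(A|B)_ρ = - inf_σ D_α(ρ_AB ‖ 1_A ⊗ σ_B)`, the infimum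
running over all density matrices `σ_B` on the second system. -/
noncomputable def condRenyiEntropyUp {a b : Type*} [Fintype a] [DecidableEq a]
    [Fintype b] [DecidableEq b] (α : ℝ) (ρ : Matrix (a × b) (a × b) ℂ) : EReal :=
  -⨅ σ : {σ : Matrix b b ℂ // IsDensityMatrix σ},
    renyiDivergence α ρ ((1 : Matrix a a ℂ) ⊗ₖ σ.1)

/-! Put `u = 1 - 1/β`, `v = 1 - 1/γ`, `t = 1 - 1/α`. The relation between the orders says `t (u + v)
= u v`. For a state `σ` on `B` and `S = 1 ⊗ σ`, consider the function `(x, 1/p) ↦ log ‖S^(x/2) ρ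
S^(x/2)‖_p`. The points `(-u, 1/β)`, `(0, 1/α)` and `(v, 1)` are collinear exactly by the relation.
The values there are `u D_β(ρ‖S)`, `-t H_α(ρ)` and `log tr (ρ_B σ^v)`; the last one sees only the
marginal because the trace norm of a positive matrix is linear.

The function is convex along lines (`tracePow_sandwich_rpow_le`). This is Stein–Hirschman style
complex interpolation: with `ρ = T* T` the quantity is `‖T S^(x/2)‖_{2p}²`, and the three lines
theorem is applied to a finite sum of exponentials built from a singular value decomposition,
bounded on the two boundary lines by Hölder's inequality. Hölder needs `2p ≥ 1`, whence the bounds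
`α, β ≥ 1/2`. The signs of `u`, `v`, `u + v` decide which point lies in the middle, but all cases
combine into one statement: `D_β(ρ‖S) + (1/v) log tr (ρ_B σ^v) + H_α(ρ)` has the sign of `u + v` or
vanishes (`interpolation_sign`, `entropy_sign`).

Scalar Hölder inequalities give `(1/v) log tr (ρ_B σ^v) ≤ -H_γ(ρ_B)` under the needed support
condition, with equality for `σ ∝ ρ_B^γ`. If `u + v > 0` the bound is used for every `σ`; if `u + v
< 0` the optimal `σ` is a witness for the infimum. For `β = 1 ≠ γ`, interpolation is replaced by
Jensen's inequality for the logarithm. The values `γ = 1` and `γ = 0` follow by letting `γ` vary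
with `β` fixed and using continuity of the entropies in their order. -/

/-! ### Scalar Hölder inequality and the three lines theorem -/

/-- **Hölder's inequality** in multiplicative form, with weights and including the endpoints. -/
theorem sum_mul_rpow_mul_rpow_le {ι : Type*} (s : Finset ι) (w x y : ι → ℝ)
    (hw : ∀ i, 0 ≤ w i) (hx : ∀ i, 0 ≤ x i) (hy : ∀ i, 0 ≤ y i) {θ : ℝ} (h0 : 0 ≤ θ) (h1 : θ ≤ 1) :
    ∑ i ∈ s, w i * (x i ^ θ * y i ^ (1 - θ)) ≤
      (∑ i ∈ s, w i * x i) ^ θ * (∑ i ∈ s, w i * y i) ^ (1 - θ) := by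
  rcases h0.eq_or_lt with rfl | h0
  · simp
  rcases h1.eq_or_lt with rfl | h1
  · simp
  have hpq : (1 / θ).HolderConjugate (1 / (1 - θ)) := by
    rw [Real.holderConjugate_iff]
    refine ⟨by rw [lt_div_iff₀ h0]; linarith, by simp⟩
  have h1' : 0 < 1 - θ := by linarith
  have key := Real.inner_le_Lp_mul_Lq_of_nonneg s (f := fun i => (w i * x i) ^ θ)
    (g := fun i => (w i * y i) ^ (1 - θ)) hpq
    (fun i _ => Real.rpow_nonneg (mul_nonneg (hw i) (hx i)) _)
    (fun i _ => Real.rpow_nonneg (mul_nonneg (hw i) (hy i)) _)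
  simp only [one_div_one_div] at key
  have e1 : ∀ i, ((w i * x i) ^ θ) ^ (1 / θ) = w i * x i := fun i => by
    rw [← Real.rpow_mul (mul_nonneg (hw i) (hx i)), mul_one_div_cancel h0.ne', Real.rpow_one]
  have e2 : ∀ i, ((w i * y i) ^ (1 - θ)) ^ (1 / (1 - θ)) = w i * y i := fun i => by
    rw [← Real.rpow_mul (mul_nonneg (hw i) (hy i)), mul_one_div_cancel h1'.ne', Real.rpow_one]
  simp only [e1, e2] at key
  refine le_trans (le_of_eq (Finset.sum_congr rfl fun i _ => ?_)) key
  rw [Real.mul_rpow (hw i) (hx i), Real.mul_rpow (hw i) (hy i)]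
  have : w i = w i ^ θ * w i ^ (1 - θ) := by
    rw [← Real.rpow_add' (hw i) (by simp)]
    simp
  calc _ = (w i ^ θ * w i ^ (1 - θ)) * (x i ^ θ * y i ^ (1 - θ)) := by rw [← this]
    _ = _ := by ring

/-- The **three lines theorem** for finite sums of exponentials with real frequencies. -/
theorem norm_sum_exp_le_interp {K : Type*} [Fintype K] (a : K → ℂ) (b d : K → ℝ) {A B θ : ℝ}
    (h0 : 0 ≤ θ) (h1 : θ ≤ 1)
    (hA : ∀ τ : ℝ, ‖∑ k, a k * Complex.exp (b k + d k * (τ * Complex.I))‖ ≤ A)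
    (hB : ∀ τ : ℝ, ‖∑ k, a k * Complex.exp (b k + d k * (1 + τ * Complex.I))‖ ≤ B) :
    ‖∑ k, a k * Complex.exp (b k + d k * (θ : ℂ))‖ ≤ A ^ (1 - θ) * B ^ θ := by
  have key := Complex.HadamardThreeLines.norm_le_interp_of_mem_verticalClosedStrip₀₁'
    (fun z : ℂ => ∑ k, a k * Complex.exp (b k + d k * z)) (z := (θ : ℂ)) (a := A) (b := B)
    (by simp [Complex.HadamardThreeLines.verticalClosedStrip, h0, h1])
    (Differentiable.diffContOnCl (by fun_prop)) ?_ ?_ ?_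
  · simpa using key
  -- The coefficients `b`, `d` are real, so the modulus of each term depends only on `z.re`;
  -- boundedness on the strip reduces to compactness of `[0, 1]`.
  · obtain ⟨M, hM⟩ := (isCompact_Icc (a := (0 : ℝ)) (b := 1)).bddAbove_image
      (f := fun t : ℝ => ∑ k, ‖a k‖ * Real.exp (b k + d k * t))
      (Continuous.continuousOn (by fun_prop))
    refine ⟨M, ?_⟩
    rintro _ ⟨z, hz, rfl⟩
    refine le_trans ?_ (hM ⟨z.re, hz, rfl⟩)
    refine (norm_sum_le _ _).trans (Finset.sum_le_sum fun k _ => ?_)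
    rw [norm_mul, Complex.norm_exp]
    simp
  · intro z hz
    have : z = (z.im : ℂ) * Complex.I := by
      conv_lhs => rw [← Complex.re_add_im z, show z.re = 0 from hz]
      simp
    rw [this]
    exact hA z.im
  · intro z hz
    have : z = 1 + (z.im : ℂ) * Complex.I := by
      conv_lhs => rw [← Complex.re_add_im z, show z.re = 1 from hz]
      simp
    rw [this]
    exact hB z.im

/-! ### Hölder's inequality for operators -/

section Hoelder

variable {E : Type*} [NormedAddCommGroup E] [InnerProductSpace ℂ E]

/-- **Hölder's inequality** for the pairing of an operator `B` having singular values `√(l j)` with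
an operator given by its singular value decomposition. -/
theorem sum_rpow_mul_norm_inner_le {ι κ : Type*} [Fintype ι] [Fintype κ] [DecidableEq κ]
    (B : E →ₗ[ℂ] E) (w : OrthonormalBasis κ ℂ E) (l : κ → ℝ) (hl : ∀ j, 0 ≤ l j)
    (hB : ∀ j k, inner ℂ (B (w j)) (B (w k)) = if j = k then (l j : ℂ) else 0)
    (u v : ι → E) (hu : Orthonormal ℂ u) (hv : Orthonormal ℂ v) (m : ι → ℝ) (hm : ∀ i, 0 ≤ m i)
    {r : ℝ} (hr : 1 ≤ r) :
    ∑ i, m i ^ (1 - 1 / r) * ‖inner ℂ (u i) (B (v i))‖ ≤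
      (∑ i, m i) ^ (1 - 1 / r) * (∑ j, l j ^ (r / 2)) ^ (1 / r) := by
  have hr0 : 0 < r := by linarith
  have hnorm : ∀ j, ‖B (w j)‖ ^ 2 = l j := fun j => by
    have := hB j j
    rw [inner_self_eq_norm_sq_to_K, if_pos rfl] at this
    exact Complex.ofReal_injective (by simpa using this)
  -- The vectors `B (w j) / √(l j)` with `l j ≠ 0` are left singular vectors of `B`, and `D i j` is
  -- their squared overlap with `u i`. Division by zero makes `D i j = 0` when `l j = 0`.
  set D : ι → κ → ℝ := fun i j => ‖inner ℂ (u i) (B (w j))‖ ^ 2 / l j with hD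
  have hD0 : ∀ i j, 0 ≤ D i j := fun i j => div_nonneg (by positivity) (hl j)
  -- The mean of the two overlap matrices is doubly substochastic and, by the inequality of
  -- arithmetic and geometric means, dominates the coefficients of `√(l j)` in `inner (u i) (B (v
  -- i))`. This reduces the claim to scalar Hölder with weights `W`.
  set W : ι → κ → ℝ := fun i j => (‖inner ℂ (w j) (v i)‖ ^ 2 + D i j) / 2 with hW
  have hW0 : ∀ i j, 0 ≤ W i j := fun i j => by have := hD0 i j; positivity
  have hDrow : ∀ i, ∑ j, D i j ≤ 1 := fun i => by
    let t : {j // l j ≠ 0} → E := fun j => (((Real.sqrt (l j))⁻¹ : ℝ) : ℂ) • B (w j)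
    have ht : Orthonormal ℂ t := by
      rw [orthonormal_iff_ite]
      intro j k
      simp only [t, inner_smul_left, inner_smul_right, hB, Complex.conj_ofReal, Subtype.ext_iff]
      split_ifs with hjk
      · rw [← hjk]
        norm_cast
        have h1 : Real.sqrt (l j) * Real.sqrt (l j) = l j := Real.mul_self_sqrt (hl j)
        have h2 : Real.sqrt (l j) ≠ 0 := by
          intro h; rw [h] at h1; exact j.2 (by simpa using h1.symm)
        field_simp
        nlinarith
      · simp
    have h1 := ht.sum_inner_products_le (u i) (s := Finset.univ)
    rw [hu.1 i, one_pow] at h1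
    refine le_trans (le_of_eq ?_) h1
    have h2 : ∀ j : {j // l j ≠ 0}, ‖inner ℂ (t j) (u i)‖ ^ 2 = D i j := fun j => by
      simp only [t, hD, inner_smul_left, norm_mul, RCLike.norm_conj, Complex.norm_real, mul_pow,
        norm_inv, Real.norm_eq_abs, sq_abs, inv_pow, Real.sq_sqrt (hl j), norm_inner_symm (u i)]
      ring
    rw [Finset.sum_congr rfl fun j _ => h2 j,
      ← Finset.sum_subtype (Finset.univ.filter (l · ≠ 0)) (by simp) (D i), Finset.sum_filter_of_ne]
    intro j _ hj h
    exact hj (by simp [hD, h])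
  have hWrow : ∀ i, ∑ j, W i j ≤ 1 := fun i => by
    have h1 : ∑ j, ‖inner ℂ (w j) (v i)‖ ^ 2 = 1 := by
      rw [w.sum_sq_norm_inner_right, hv.1 i, one_pow]
    simp only [hW]
    rw [← Finset.sum_div, Finset.sum_add_distrib]
    linarith [hDrow i]
  have hWcol : ∀ j, ∑ i, W i j ≤ 1 := fun j => by
    have h1 : ∑ i, ‖inner ℂ (w j) (v i)‖ ^ 2 ≤ 1 := by
      have := hv.sum_inner_products_le (w j) (s := Finset.univ)
      rw [w.orthonormal.1 j, one_pow] at this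
      simpa only [norm_inner_symm (w j)] using this
    have h2 : ∑ i, D i j ≤ 1 := by
      have := hu.sum_inner_products_le (B (w j)) (s := Finset.univ)
      rw [hnorm] at this
      simp only [hD]
      rw [← Finset.sum_div]
      exact div_le_one_of_le₀ this (hl j)
    simp only [hW]
    rw [← Finset.sum_div, Finset.sum_add_distrib]
    linarith
  have hterm : ∀ i, ‖inner ℂ (u i) (B (v i))‖ ≤ ∑ j, W i j * (l j ^ (r / 2)) ^ (1 / r) := fun i => by
    have : inner ℂ (u i) (B (v i)) = ∑ j, inner ℂ (w j) (v i) * inner ℂ (u i) (B (w j)) := by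
      conv_lhs => rw [← w.sum_repr' (v i)]
      simp only [map_sum, map_smul, inner_sum, inner_smul_right]
    rw [this]
    refine (norm_sum_le _ _).trans (Finset.sum_le_sum fun j _ => ?_)
    rw [norm_mul, ← Real.rpow_mul (hl j), show r / 2 * (1 / r) = 1 / 2 by field_simp,
      ← Real.sqrt_eq_rpow]
    set a := ‖inner ℂ (w j) (v i)‖
    set c := ‖inner ℂ (u i) (B (w j))‖ with hc
    rcases (hl j).eq_or_lt with h | h
    · have : B (w j) = 0 := by
        rw [← norm_eq_zero, ← sq_eq_zero_iff, hnorm, ← h]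
      simp [hc, this, ← h]
    · have hs : 0 < Real.sqrt (l j) := Real.sqrt_pos.2 h
      have h2 : c ^ 2 / l j = (c / Real.sqrt (l j)) ^ 2 := by
        rw [div_pow, Real.sq_sqrt h.le]
      simp only [hW, hD]
      rw [h2]
      have h3 : c = c / Real.sqrt (l j) * Real.sqrt (l j) := by field_simp
      calc a * c = a * (c / Real.sqrt (l j)) * Real.sqrt (l j) := by rw [mul_assoc, ← h3]
        _ ≤ _ := by
          gcongr
          nlinarith [sq_nonneg (a - c / Real.sqrt (l j))]
  calc ∑ i, m i ^ (1 - 1 / r) * ‖inner ℂ (u i) (B (v i))‖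
      ≤ ∑ i, m i ^ (1 - 1 / r) * ∑ j, W i j * (l j ^ (r / 2)) ^ (1 / r) := by
        gcongr with i
        · exact Real.rpow_nonneg (hm i) _
        · exact hterm i
    _ = ∑ k : ι × κ, W k.1 k.2 * (((l k.2 ^ (r / 2)) ^ (1 / r)) * (m k.1) ^ (1 - 1 / r)) := by
        rw [Fintype.sum_prod_type]
        refine Finset.sum_congr rfl fun i _ => ?_
        rw [Finset.mul_sum]
        exact Finset.sum_congr rfl fun j _ => by ring
    _ ≤ (∑ k : ι × κ, W k.1 k.2 * l k.2 ^ (r / 2)) ^ (1 / r) *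
          (∑ k : ι × κ, W k.1 k.2 * m k.1) ^ (1 - 1 / r) :=
        sum_mul_rpow_mul_rpow_le _ _ (fun k : ι × κ => l k.2 ^ (r / 2)) (fun k : ι × κ => m k.1)
          (fun k => hW0 _ _) (fun k => Real.rpow_nonneg (hl _) _) (fun k => hm _) (by positivity)
          (by rw [div_le_one hr0]; exact hr)
    _ ≤ (∑ j, l j ^ (r / 2)) ^ (1 / r) * (∑ i, m i) ^ (1 - 1 / r) := by
        have hr1 : 0 ≤ 1 - 1 / r := by rw [sub_nonneg, div_le_one hr0]; exact hr
        gcongr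
        · exact Real.rpow_nonneg (Finset.sum_nonneg fun k _ => mul_nonneg (hW0 _ _) (hm _)) _
        · exact Real.rpow_nonneg (Finset.sum_nonneg fun j _ => Real.rpow_nonneg (hl j) _) _
        · exact Finset.sum_nonneg fun k _ => mul_nonneg (hW0 _ _) (Real.rpow_nonneg (hl _) _)
        · rw [Fintype.sum_prod_type_right]
          refine Finset.sum_le_sum fun j _ => ?_
          dsimp only
          rw [← Finset.sum_mul]
          exact mul_le_of_le_one_left (Real.rpow_nonneg (hl j) _) (hWcol j)
        · exact Finset.sum_nonneg fun k _ => mul_nonneg (hW0 _ _) (hm _)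
        · rw [Fintype.sum_prod_type]
          refine Finset.sum_le_sum fun i _ => ?_
          dsimp only
          rw [← Finset.sum_mul]
          exact mul_le_of_le_one_left (hm i) (hWrow i)
    _ = _ := mul_comm _ _

end Hoelder

/-! ### Eigenbases and functional calculus -/

namespace Matrix

variable {n : Type*} [Fintype n] [DecidableEq n]

/-- The operator on Euclidean space given by a square matrix. -/
noncomputable abbrev op (M : Matrix n n ℂ) : EuclideanSpace ℂ n →L[ℂ] EuclideanSpace ℂ n :=
  toEuclideanCLM (𝕜 := ℂ) M

theorem op_mul_apply (A B : Matrix n n ℂ) (x : EuclideanSpace ℂ n) :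
    (A * B).op x = A.op (B.op x) := by
  simp [op]

theorem inner_op_left (A : Matrix n n ℂ) (x y : EuclideanSpace ℂ n) :
    inner ℂ (A.op x) y = inner ℂ x (Aᴴ.op y) := by
  have : Aᴴ.op = ContinuousLinearMap.adjoint A.op := by
    rw [← ContinuousLinearMap.star_eq_adjoint, ← map_star]
    rfl
  rw [this, ContinuousLinearMap.adjoint_inner_right]

theorem inner_op_left_of_isHermitian {A : Matrix n n ℂ} (hA : A.IsHermitian)
    (x y : EuclideanSpace ℂ n) : inner ℂ (A.op x) y = inner ℂ x (A.op y) := by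
  rw [inner_op_left, hA.eq]

theorem trace_eq_sum_inner_op {ι : Type*} [Fintype ι] (M : Matrix n n ℂ)
    (b : OrthonormalBasis ι ℂ (EuclideanSpace ℂ n)) :
    M.trace = ∑ i, inner ℂ (b i) (M.op (b i)) := by
  have h1 : LinearMap.trace ℂ (EuclideanSpace ℂ n) (M.op : EuclideanSpace ℂ n →ₗ[ℂ] _) =
      M.trace := by
    rw [LinearMap.trace_eq_matrix_trace ℂ (EuclideanSpace.basisFun n ℂ).toBasis]
    congr 1
    ext i j
    simp [LinearMap.toMatrix_apply, op]
  rw [← h1, LinearMap.trace_eq_sum_inner _ b]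
  rfl

theorem eq_of_op_eq {ι : Type*} [Fintype ι] {A B : Matrix n n ℂ}
    (b : OrthonormalBasis ι ℂ (EuclideanSpace ℂ n)) (h : ∀ i, A.op (b i) = B.op (b i)) : A = B := by
  apply (toEuclideanCLM (n := n) (𝕜 := ℂ)).injective
  apply ContinuousLinearMap.coe_injective
  exact b.toBasis.ext fun i => by rw [OrthonormalBasis.coe_toBasis]; exact h i

theorem mulVec_eq_zero_iff_op (A : Matrix n n ℂ) (v : n → ℂ) :
    A.mulVec v = 0 ↔ A.op (WithLp.toLp 2 v) = 0 := by
  rw [op, toEuclideanCLM_toLp]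
  exact (WithLp.toLp_eq_zero 2).symm

namespace IsHermitian

variable {A B : Matrix n n ℂ} (hA : A.IsHermitian) (hB : B.IsHermitian)

theorem isHermitian_cfc (A : Matrix n n ℂ) (f : ℝ → ℝ) : (cfc f A).IsHermitian :=
  cfc_predicate (p := IsSelfAdjoint) f A

theorem op_cfc_apply (f : ℝ → ℝ) (i : n) :
    (cfc f A).op (hA.eigenvectorBasis i) = (f (hA.eigenvalues i) : ℂ) • hA.eigenvectorBasis i := by
  have h := star_eigenvectorUnitary_mulVec hA i
  have h2 := eigenvectorUnitary_mulVec hA i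
  rw [hA.cfc_eq, IsHermitian.cfc, Unitary.conjStarAlgAut_apply]
  apply (WithLp.equiv 2 (n → ℂ)).injective
  change (_ * _ * _) *ᵥ (hA.eigenvectorBasis i).ofLp = _
  rw [← mulVec_mulVec, ← mulVec_mulVec, h, diagonal_mulVec_single]
  simp only [Function.comp_apply, mul_one]
  rw [show (Pi.single i (RCLike.ofReal (f (hA.eigenvalues i))) : n → ℂ) =
    ((f (hA.eigenvalues i) : ℂ)) • Pi.single i 1 by simp [← Pi.single_smul], mulVec_smul, h2]
  rfl

theorem op_apply (i : n) :
    A.op (hA.eigenvectorBasis i) = (hA.eigenvalues i : ℂ) • hA.eigenvectorBasis i := by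
  have := hA.op_cfc_apply (fun x => x) i
  rwa [cfc_id' ℝ A hA.isSelfAdjoint] at this

theorem trace_mul_cfc (M : Matrix n n ℂ) (f : ℝ → ℝ) :
    (M * cfc f A).trace = ∑ i, (f (hA.eigenvalues i) : ℂ) *
      inner ℂ (hA.eigenvectorBasis i) (M.op (hA.eigenvectorBasis i)) := by
  rw [trace_eq_sum_inner_op _ hA.eigenvectorBasis]
  simp only [op_mul_apply, op_cfc_apply, map_smul, inner_smul_right]

theorem trace_cfc (f : ℝ → ℝ) :
    (cfc f A).trace = ∑ i, (f (hA.eigenvalues i) : ℂ) := by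
  have := hA.trace_mul_cfc 1 f
  simpa using this

theorem re_trace_cfc (f : ℝ → ℝ) :
    (cfc f A).trace.re = ∑ i, f (hA.eigenvalues i) := by
  rw [hA.trace_cfc]
  simp

/-- Expanding in both eigenbases turns the trace of a noncommuting product into a classical double
sum weighted by squared overlaps; this makes scalar inequalities applicable. -/
theorem re_trace_cfc_mul_cfc (f g : ℝ → ℝ) :
    (cfc f A * cfc g B).trace.re = ∑ i, ∑ j,
      ‖inner ℂ (hA.eigenvectorBasis i) (hB.eigenvectorBasis j)‖ ^ 2 *
        (f (hA.eigenvalues i) * g (hB.eigenvalues j)) := by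
  rw [hB.trace_mul_cfc, Finset.sum_comm, Complex.re_sum]
  refine Finset.sum_congr rfl fun j _ => ?_
  have : inner ℂ (hB.eigenvectorBasis j) ((cfc f A).op (hB.eigenvectorBasis j)) =
      ((∑ i, f (hA.eigenvalues i) *
        ‖inner ℂ (hA.eigenvectorBasis i) (hB.eigenvectorBasis j)‖ ^ 2 : ℝ) : ℂ) := by
    rw [← hA.eigenvectorBasis.sum_inner_mul_inner]
    push_cast
    refine Finset.sum_congr rfl fun i _ => ?_
    rw [← inner_op_left_of_isHermitian (isHermitian_cfc A f), op_cfc_apply, inner_smul_left,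
      Complex.conj_ofReal, ← mul_assoc, mul_comm (inner ℂ _ _), mul_assoc,
      ← inner_conj_symm (hB.eigenvectorBasis j), Complex.conj_mul']
  rw [this, ← Complex.ofReal_mul, Complex.ofReal_re, Finset.mul_sum]
  exact Finset.sum_congr rfl fun i _ => by ring

theorem cfc_mul_cfc {A : Matrix n n ℂ} (hA : A.IsHermitian) (f g : ℝ → ℝ) : cfc f A * cfc g A = cfc (fun x => f x * g x) A := by
  apply eq_of_op_eq hA.eigenvectorBasis
  intro i
  rw [op_mul_apply, op_cfc_apply, op_cfc_apply, map_smul, op_cfc_apply, smul_smul]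
  push_cast
  rw [mul_comm]

theorem cfc_congr_eigenvalues {f g : ℝ → ℝ}
    (h : ∀ i, f (hA.eigenvalues i) = g (hA.eigenvalues i)) : cfc f A = cfc g A := by
  apply eq_of_op_eq hA.eigenvectorBasis
  intro i
  rw [op_cfc_apply, op_cfc_apply, h]

theorem cfc_cfc {A : Matrix n n ℂ} (hA : A.IsHermitian) (f g : ℝ → ℝ) : cfc g (cfc f A) = cfc (fun x => g (f x)) A :=
  (cfc_comp g f A hA.isSelfAdjoint (((finite_real_spectrum (A := A)).image f).continuousOn _)
    ((finite_real_spectrum (A := A)).continuousOn _)).symm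

end IsHermitian

end Matrix

/-! ### Logarithmic convexity of Schatten norms of sandwiched products -/

/-- The powers of `N` on the right of `three` combine to `N ^ (1 - 1 / (2 * p))`. Cancelling this
factor leaves a bound on `N ^ (1 / (2 * p))`, which is then squared. -/
theorem rpow_one_div_le_of_le_interp {N Q₀ Q₁ p p₀ p₁ θ : ℝ} (hN0 : 0 ≤ N) (hQ₀ : 0 ≤ Q₀)
    (hQ₁ : 0 ≤ Q₁) (hp₀ : 0 < p₀) (hp₁ : 0 < p₁) (hp : 0 < p)
    (hpp : 1 / p = (1 - θ) / p₀ + θ / p₁)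
    (three : N ≤ (N ^ (1 - 1 / (2 * p₀)) * Q₀ ^ (1 / (2 * p₀))) ^ (1 - θ) *
      (N ^ (1 - 1 / (2 * p₁)) * Q₁ ^ (1 / (2 * p₁))) ^ θ) :
    N ^ (1 / p) ≤ (Q₀ ^ (1 / p₀)) ^ (1 - θ) * (Q₁ ^ (1 / p₁)) ^ θ := by
  rcases hN0.eq_or_lt with hN' | hN'
  · rw [← hN', Real.zero_rpow (by positivity)]
    positivity
  have e1 : (N ^ (1 - 1 / (2 * p₀)) * Q₀ ^ (1 / (2 * p₀))) ^ (1 - θ) *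
      (N ^ (1 - 1 / (2 * p₁)) * Q₁ ^ (1 / (2 * p₁))) ^ θ =
      N ^ (1 - 1 / (2 * p)) * (Q₀ ^ ((1 - θ) / (2 * p₀)) * Q₁ ^ (θ / (2 * p₁))) := by
    have hNe : 1 - 1 / (2 * p) = (1 - 1 / (2 * p₀)) * (1 - θ) + (1 - 1 / (2 * p₁)) * θ := by
      have : 1 / (2 * p) = (1 / p) / 2 := by field_simp
      rw [this, hpp]
      field_simp
      ring
    rw [Real.mul_rpow (by positivity) (by positivity), Real.mul_rpow (by positivity) (by positivity),
      ← Real.rpow_mul hN0, ← Real.rpow_mul hN0, ← Real.rpow_mul hQ₀, ← Real.rpow_mul hQ₁, hNe,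
      Real.rpow_add hN', show 1 / (2 * p₀) * (1 - θ) = (1 - θ) / (2 * p₀) by ring,
      show 1 / (2 * p₁) * θ = θ / (2 * p₁) by ring]
    ring
  rw [e1] at three
  have e2 : N ^ (1 - 1 / (2 * p)) * N ^ (1 / (2 * p)) = N := by
    rw [← Real.rpow_add hN']
    simp
  have hpos : 0 < N ^ (1 - 1 / (2 * p)) := Real.rpow_pos_of_pos hN' _
  have e3 : N ^ (1 / (2 * p)) ≤ Q₀ ^ ((1 - θ) / (2 * p₀)) * Q₁ ^ (θ / (2 * p₁)) :=
    le_of_mul_le_mul_left (e2.le.trans three) hpos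
  have e4 := Real.rpow_le_rpow (Real.rpow_nonneg hN0 _) e3 zero_le_two
  rw [Real.mul_rpow (by positivity) (by positivity), ← Real.rpow_mul hN0, ← Real.rpow_mul hQ₀,
    ← Real.rpow_mul hQ₁] at e4
  rw [← Real.rpow_mul hQ₀, ← Real.rpow_mul hQ₁,
    show 1 / p = 1 / (2 * p) * 2 by field_simp,
    show 1 / p₀ * (1 - θ) = (1 - θ) / (2 * p₀) * 2 by field_simp,
    show 1 / p₁ * θ = θ / (2 * p₁) * 2 by field_simp]
  exact e4

namespace Matrix

variable {n : Type*} [Fintype n] [DecidableEq n]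

/-- The trace of the power `A ^ p` of a positive semi-definite matrix. -/
noncomputable def tracePow (A : Matrix n n ℂ) (p : ℝ) : ℝ := (matrixPow A p).trace.re

/-- The sandwiched product `S ^ (x / 2) * R * S ^ (x / 2)`. -/
noncomputable def sandwich (S R : Matrix n n ℂ) (x : ℝ) : Matrix n n ℂ :=
  matrixPow S (x / 2) * R * matrixPow S (x / 2)

theorem IsHermitian.tracePow_eq_sum {A : Matrix n n ℂ} (hA : A.IsHermitian) (p : ℝ) :
    A.tracePow p = ∑ i, hA.eigenvalues i ^ p :=
  hA.re_trace_cfc _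

theorem PosSemidef.tracePow_nonneg {A : Matrix n n ℂ} (hA : A.PosSemidef) (p : ℝ) :
    0 ≤ A.tracePow p := by
  rw [hA.isHermitian.tracePow_eq_sum]
  exact Finset.sum_nonneg fun i _ => Real.rpow_nonneg (hA.eigenvalues_nonneg i) _

theorem conjTranspose_matrixPow (S : Matrix n n ℂ) (x : ℝ) : (matrixPow S x)ᴴ = matrixPow S x :=
  IsHermitian.isHermitian_cfc S _

theorem sandwich_conjTranspose_mul_self (S T : Matrix n n ℂ) (x : ℝ) :
    sandwich S (Tᴴ * T) x = (T * matrixPow S (x / 2))ᴴ * (T * matrixPow S (x / 2)) := by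
  rw [sandwich, conjTranspose_mul, conjTranspose_matrixPow]
  simp only [mul_assoc]

theorem PosSemidef.exists_eq_conjTranspose_mul_self {R : Matrix n n ℂ} (hR : R.PosSemidef) :
    ∃ T : Matrix n n ℂ, R = Tᴴ * T := by
  open scoped MatrixOrder in
  exact CStarAlgebra.nonneg_iff_eq_star_mul_self.mp hR.nonneg

theorem PosSemidef.sandwich {R : Matrix n n ℂ} (hR : R.PosSemidef) (S : Matrix n n ℂ) (x : ℝ) :
    (sandwich S R x).PosSemidef := by
  obtain ⟨T, rfl⟩ := hR.exists_eq_conjTranspose_mul_self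
  rw [sandwich_conjTranspose_mul_self]
  exact posSemidef_conjTranspose_mul_self _

theorem IsHermitian.op_matrixPow_apply {S : Matrix n n ℂ} (hS : S.IsHermitian) (x : ℝ) (j : n) :
    (matrixPow S x).op (hS.eigenvectorBasis j) =
      ((hS.eigenvalues j ^ x : ℝ) : ℂ) • hS.eigenvectorBasis j :=
  hS.op_cfc_apply _ j

/-- A bound, on a vertical line, of the analytic function interpolating between
sandwiched products. -/
theorem norm_sum_inner_mul_exp_le (T S : Matrix n n ℂ) (hS : S.PosSemidef) {ι : Type*} [Fintype ι]
    (u v : ι → EuclideanSpace ℂ n) (hu : Orthonormal ℂ u) (hv : Orthonormal ℂ v)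
    (hker : ∀ i j, hS.isHermitian.eigenvalues j = 0 →
      inner ℂ (hS.isHermitian.eigenvectorBasis j) (v i) = 0)
    (m : ι → ℝ) (hm : ∀ i, 0 < m i) {r : ℝ} (hr : 1 ≤ r) (x : ℝ) (g : ι → ℝ) (h : n → ℝ) (τ : ℝ) :
    ‖∑ k : ι × n, inner ℂ (u k.1) (T.op (hS.isHermitian.eigenvectorBasis k.2)) *
        inner ℂ (hS.isHermitian.eigenvectorBasis k.2) (v k.1) *
        Complex.exp (((1 - 1 / r) * Real.log (m k.1) +
          x / 2 * Real.log (hS.isHermitian.eigenvalues k.2) : ℝ) +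
            ((g k.1 + h k.2 : ℝ) : ℂ) * (τ * Complex.I))‖ ≤
      (∑ i, m i) ^ (1 - 1 / r) * (sandwich S (Tᴴ * T) x).tracePow (r / 2) ^ (1 / r) := by
  classical
  set f := hS.isHermitian.eigenvectorBasis with hf
  set s := hS.isHermitian.eigenvalues with hs
  have hs0 : ∀ j, 0 ≤ s j := hS.eigenvalues_nonneg
  -- On a vertical line the imaginary parts contribute only phases. The `d j` act as a diagonal
  -- unitary in the eigenbasis of `S`, so they are absorbed into `v` without losing orthonormality;
  -- the `e i` drop out of the norm.
  let d : n → ℂ := fun j => Complex.exp ((h j * τ : ℝ) * Complex.I)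
  let e : ι → ℂ := fun i => Complex.exp ((g i * τ : ℝ) * Complex.I)
  have hd : ∀ j, ‖d j‖ = 1 := fun j => Complex.norm_exp_ofReal_mul_I _
  have he : ∀ i, ‖e i‖ = 1 := fun j => Complex.norm_exp_ofReal_mul_I _
  let U : ι → EuclideanSpace ℂ n := fun i => ∑ j, (d j * inner ℂ (f j) (v i)) • f j
  have hfU : ∀ i j, inner ℂ (f j) (U i) = d j * inner ℂ (f j) (v i) := fun i j => by
    simp only [U]
    rw [f.orthonormal.inner_right_fintype]
  have hU : Orthonormal ℂ U := by
    rw [orthonormal_iff_ite] at hv ⊢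
    intro i j
    rw [← hv i j, ← f.sum_inner_mul_inner, ← f.sum_inner_mul_inner (v i)]
    refine Finset.sum_congr rfl fun k _ => ?_
    rw [← inner_conj_symm, hfU, hfU, map_mul, inner_conj_symm]
    have : (starRingEnd ℂ) (d k) * d k = 1 := by
      rw [Complex.conj_mul', hd]; simp
    linear_combination (inner ℂ (v i) (f k) * inner ℂ (f k) (v j)) * this
  set A := Matrix.sandwich S (Tᴴ * T) x with hA
  have hA' : A = (T * matrixPow S (x / 2))ᴴ * (T * matrixPow S (x / 2)) :=
    sandwich_conjTranspose_mul_self S T x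
  have hApos : A.PosSemidef := (posSemidef_conjTranspose_mul_self T).sandwich S x
  have key := sum_rpow_mul_norm_inner_le ((T * matrixPow S (x / 2)).op : _ →ₗ[ℂ] _)
    hApos.isHermitian.eigenvectorBasis hApos.isHermitian.eigenvalues hApos.eigenvalues_nonneg ?_
    u U hu hU m (fun i => (hm i).le) hr
  · rw [hApos.isHermitian.tracePow_eq_sum]
    refine le_trans ?_ key
    rw [Fintype.sum_prod_type]
    refine (norm_sum_le _ _).trans (Finset.sum_le_sum fun i _ => le_of_eq ?_)
    have hBU : inner ℂ (u i) ((T * matrixPow S (x / 2)).op (U i)) =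
        ∑ j, d j * inner ℂ (f j) (v i) * ((s j ^ (x / 2) : ℝ) : ℂ) * inner ℂ (u i) (T.op (f j)) := by
      simp only [U, map_sum, map_smul, inner_sum, inner_smul_right, op_mul_apply]
      refine Finset.sum_congr rfl fun j _ => ?_
      rw [hS.isHermitian.op_matrixPow_apply, map_smul, inner_smul_right]
      ring
    have hsplit : ∑ j, inner ℂ (u i) (T.op (f j)) * inner ℂ (f j) (v i) *
        Complex.exp (((1 - 1 / r) * Real.log (m i) + x / 2 * Real.log (s j) : ℝ) +
            ((g i + h j : ℝ) : ℂ) * (τ * Complex.I)) =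
        e i * ((m i ^ (1 - 1 / r) : ℝ) : ℂ) *
          inner ℂ (u i) ((T * matrixPow S (x / 2)).op (U i)) := by
      rw [hBU, Finset.mul_sum]
      refine Finset.sum_congr rfl fun j _ => ?_
      -- Here `Real.log 0 = 0` makes the exponential disagree with `0 ^ (x / 2)`; `hker` removes
      -- these terms.
      rcases eq_or_ne (s j) 0 with h0 | h0
      · rw [hker i j h0]; ring
      · have h0' : 0 < s j := lt_of_le_of_ne (hs0 j) h0.symm
        have : Complex.exp (((1 - 1 / r) * Real.log (m i) + x / 2 * Real.log (s j) : ℝ) +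
            ((g i + h j : ℝ) : ℂ) * (τ * Complex.I)) =
            e i * d j * ((m i ^ (1 - 1 / r) : ℝ) : ℂ) * ((s j ^ (x / 2) : ℝ) : ℂ) := by
          rw [Real.rpow_def_of_pos (hm i), Real.rpow_def_of_pos h0', Complex.ofReal_exp,
            Complex.ofReal_exp]
          simp only [e, d]
          rw [← Complex.exp_add, ← Complex.exp_add, ← Complex.exp_add]
          congr 1
          push_cast
          ring
        rw [this]
        ring
    dsimp only
    rw [hsplit, norm_mul, norm_mul, he, one_mul, Complex.norm_real, Real.norm_eq_abs,
      abs_of_nonneg (Real.rpow_nonneg (hm i).le _)]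
    rfl
  · intro j k
    change inner ℂ ((T * matrixPow S (x / 2)).op _) ((T * matrixPow S (x / 2)).op _) = _
    rw [inner_op_left, ← op_mul_apply, ← hA', hApos.isHermitian.op_apply, inner_smul_right,
      orthonormal_iff_ite.mp hApos.isHermitian.eigenvectorBasis.orthonormal]
    split_ifs with hjk
    · rw [hjk, mul_one]
    · simp

/-- **Logarithmic convexity** of the Schatten (quasi-)norms of sandwiched products. -/
theorem tracePow_sandwich_rpow_le {R S : Matrix n n ℂ} (hR : R.PosSemidef) (hS : S.PosSemidef)
    {p p₀ p₁ x₀ x₁ y θ : ℝ} (h0 : 0 ≤ θ) (h1 : θ ≤ 1) (hp₀ : 1 / 2 ≤ p₀) (hp₁ : 1 / 2 ≤ p₁)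
    (hp : 0 < p) (hpp : 1 / p = (1 - θ) / p₀ + θ / p₁) (hy : y = (1 - θ) * x₀ + θ * x₁)
    (hdom : Dominates S (sandwich S R y)) :
    (sandwich S R y).tracePow p ^ (1 / p) ≤
      ((sandwich S R x₀).tracePow p₀ ^ (1 / p₀)) ^ (1 - θ) *
        ((sandwich S R x₁).tracePow p₁ ^ (1 / p₁)) ^ θ := by
  obtain ⟨T, hT⟩ := hR.exists_eq_conjTranspose_mul_self
  set A := sandwich S R y with hA
  have hA' : A = (T * matrixPow S (y / 2))ᴴ * (T * matrixPow S (y / 2)) := by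
    rw [hA, hT, sandwich_conjTranspose_mul_self S T y]
  have hApos : A.PosSemidef := hR.sandwich S y
  set κ := hApos.isHermitian.eigenvalues with hκ
  set e := hApos.isHermitian.eigenvectorBasis with he
  have hκ0 : ∀ i, 0 ≤ κ i := hApos.eigenvalues_nonneg
  set f := hS.isHermitian.eigenvectorBasis with hf
  set s := hS.isHermitian.eigenvalues with hs
  -- `v` and `u` are the right and left singular vectors of `T * matrixPow S (y / 2)` for its
  -- nonzero singular values `√(κ i)`.
  let v : {i // 0 < κ i} → EuclideanSpace ℂ n := fun i => e i
  let u : {i // 0 < κ i} → EuclideanSpace ℂ n := fun i =>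
    (((Real.sqrt (κ i))⁻¹ : ℝ) : ℂ) • (T * matrixPow S (y / 2)).op (e i)
  have hv : Orthonormal ℂ v := e.orthonormal.comp _ Subtype.val_injective
  have hBB : ∀ i k, inner ℂ ((T * matrixPow S (y / 2)).op (e i))
      ((T * matrixPow S (y / 2)).op (e k)) = if i = k then (κ k : ℂ) else 0 := fun i k => by
    rw [inner_op_left, ← op_mul_apply, ← hA', hApos.isHermitian.op_apply, inner_smul_right,
      orthonormal_iff_ite.mp hApos.isHermitian.eigenvectorBasis.orthonormal]
    split_ifs <;> simp [hκ]
  have hsq : ∀ i : {i // 0 < κ i}, Real.sqrt (κ i) * Real.sqrt (κ i) = κ i :=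
    fun i => Real.mul_self_sqrt i.2.le
  have hsq0 : ∀ i : {i // 0 < κ i}, Real.sqrt (κ i) ≠ 0 := fun i => (Real.sqrt_pos.2 i.2).ne'
  have hu : Orthonormal ℂ u := by
    rw [orthonormal_iff_ite]
    intro i k
    simp only [u, inner_smul_left, inner_smul_right, hBB, Complex.conj_ofReal, Subtype.ext_iff]
    split_ifs with hik
    · rw [← hik]
      norm_cast
      have := hsq0 i
      field_simp
      nlinarith [hsq i]
    · simp
  -- By domination the kernel of `S` lies in the kernel of `A`, hence is orthogonal to the
  -- eigenvectors of `A` with positive eigenvalue.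
  have hker : ∀ i j, s j = 0 → inner ℂ (f j) (v i) = 0 := fun i j hj => by
    have h2 : A.op (f j) = 0 := by
      have := hdom (f j).ofLp (by
        rw [mulVec_eq_zero_iff_op]
        change S.op (f j) = 0
        rw [hS.isHermitian.op_apply, ← hs, hj]
        simp)
      rw [mulVec_eq_zero_iff_op] at this
      exact this
    have h3 : inner ℂ (f j) (A.op (e i)) = 0 := by
      rw [← inner_op_left_of_isHermitian hApos.isHermitian, h2, inner_zero_left]
    rw [hApos.isHermitian.op_apply, inner_smul_right] at h3
    rcases mul_eq_zero.mp h3 with h | h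
    · exact absurd (by exact_mod_cast h) i.2.ne'
    · exact h
  let m : {i // 0 < κ i} → ℝ := fun i => κ i ^ p
  have hm : ∀ i, 0 < m i := fun i => Real.rpow_pos_of_pos i.2 _
  have hmsum : ∑ i, m i = A.tracePow p := by
    rw [hApos.isHermitian.tracePow_eq_sum]
    rw [← Finset.sum_subtype (Finset.univ.filter (0 < κ ·)) (by simp) (fun i => κ i ^ p),
      Finset.sum_filter_of_ne]
    intro i _ hi
    refine lt_of_le_of_ne (hκ0 i) fun h => hi ?_
    rw [← h, Real.zero_rpow hp.ne']
  set N := A.tracePow p with hN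
  have hN0 : 0 ≤ N := hApos.tracePow_nonneg p
  have hp₀' : 0 < p₀ := by linarith
  have hp₁' : 0 < p₁ := by linarith
  -- The Schatten index `p'` of `A` is the index `2 * p'` of its factor `T S^(x/2)`, so Hölder
  -- requires `p' ≥ 1 / 2`.
  have hline : ∀ (p' x : ℝ), 1 / 2 ≤ p' → _ := fun p' x hp' =>
    norm_sum_inner_mul_exp_le T S hS u v hu hv hker m hm (r := 2 * p') (by linarith) x
      (fun i => (1 / (2 * p₀) - 1 / (2 * p₁)) * Real.log (m i))
      (fun j => (x₁ - x₀) / 2 * Real.log (s j))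
  have three := norm_sum_exp_le_interp (K := {i // 0 < κ i} × n)
    (fun k => inner ℂ (u k.1) (T.op (f k.2)) * inner ℂ (f k.2) (v k.1))
    (fun k => (1 - 1 / (2 * p₀)) * Real.log (m k.1) + x₀ / 2 * Real.log (s k.2))
    (fun k => (1 / (2 * p₀) - 1 / (2 * p₁)) * Real.log (m k.1) +
      (x₁ - x₀) / 2 * Real.log (s k.2))
    h0 h1 (fun τ => hline p₀ x₀ hp₀ τ) (fun τ => by
      refine le_trans (le_of_eq ?_) (hline p₁ x₁ hp₁ τ)
      congr 1
      refine Finset.sum_congr rfl fun k _ => ?_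
      congr 2
      push_cast
      ring)
  rw [hmsum, ← hT, mul_div_cancel_left₀ _ two_ne_zero, mul_div_cancel_left₀ _ two_ne_zero] at three
  -- At `θ` the weight `m i` has exponent `1 - 1 / (2 * p)`, that is, `κ i` has exponent `p - 1 /
  -- 2`. The pairing `inner (u i) (T S^(y/2) (v i))` supplies the missing `κ i ^ (1 / 2)`, and the
  -- sum is exactly `tr A ^ p`.
  have hmid : ∑ k : {i // 0 < κ i} × n, inner ℂ (u k.1) (T.op (f k.2)) *
      inner ℂ (f k.2) (v k.1) * Complex.exp
        (((1 - 1 / (2 * p₀)) * Real.log (m k.1) + x₀ / 2 * Real.log (s k.2) : ℝ) +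
        ((1 / (2 * p₀) - 1 / (2 * p₁)) * Real.log (m k.1) +
          (x₁ - x₀) / 2 * Real.log (s k.2) : ℝ) * (θ : ℂ)) = (N : ℂ) := by
    rw [← hmsum, Fintype.sum_prod_type, Complex.ofReal_sum]
    refine Finset.sum_congr rfl fun i _ => ?_
    have hlog : Real.log (m i) = p * Real.log (κ i) := Real.log_rpow i.2 _
    have hBv : (T * matrixPow S (y / 2)).op (v i) =
        ∑ j, (((s j ^ (y / 2) : ℝ) : ℂ) * inner ℂ (f j) (v i)) • T.op (f j) := by
      conv_lhs => rw [← f.sum_repr' (v i)]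
      simp only [map_sum, map_smul, op_mul_apply]
      refine Finset.sum_congr rfl fun j _ => ?_
      rw [hS.isHermitian.op_matrixPow_apply, map_smul, smul_smul, mul_comm]
    have huB : inner ℂ (u i) ((T * matrixPow S (y / 2)).op (v i)) = ((κ i ^ (1 / 2 : ℝ) : ℝ) : ℂ) := by
      simp only [u, v, inner_smul_left, hBB, Complex.conj_ofReal, if_true]
      rw [← Real.sqrt_eq_rpow]
      norm_cast
      have := hsq0 i
      field_simp
      nlinarith [hsq i]
    rw [hBv, inner_sum] at huB
    simp only [inner_smul_right] at huB
    have hfac : (m i : ℂ) = ((κ i ^ (p - 1 / 2) : ℝ) : ℂ) * ((κ i ^ (1 / 2 : ℝ) : ℝ) : ℂ) := by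
      rw [← Complex.ofReal_mul, ← Real.rpow_add i.2]
      simp [m]
    rw [hfac, ← huB, Finset.mul_sum]
    refine Finset.sum_congr rfl fun j _ => ?_
    rcases eq_or_ne (s j) 0 with hj | hj
    · simp [hker i j hj]
    · have hj' : 0 < s j := lt_of_le_of_ne (hS.eigenvalues_nonneg j) hj.symm
      have : Complex.exp
        (((1 - 1 / (2 * p₀)) * Real.log (m i) + x₀ / 2 * Real.log (s j) : ℝ) +
        ((1 / (2 * p₀) - 1 / (2 * p₁)) * Real.log (m i) +
          (x₁ - x₀) / 2 * Real.log (s j) : ℝ) * (θ : ℂ)) =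
          ((κ i ^ (p - 1 / 2) : ℝ) : ℂ) * ((s j ^ (y / 2) : ℝ) : ℂ) := by
        rw [Real.rpow_def_of_pos i.2, Real.rpow_def_of_pos hj', ← Complex.ofReal_mul,
          ← Complex.ofReal_mul, ← Complex.ofReal_add, ← Complex.ofReal_exp, ← Real.exp_add]
        congr 2
        rw [hlog, hy]
        have : p * (1 / p) = 1 := mul_one_div_cancel hp.ne'
        rw [hpp] at this
        field_simp at this ⊢
        linear_combination (- Real.log (κ i)) * this
      dsimp only
      rw [this]
      ring
  beta_reduce at three
  rw [hmid, Complex.norm_real, Real.norm_eq_abs, abs_of_nonneg hN0] at three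
  exact rpow_one_div_le_of_le_interp hN0 ((hR.sandwich S x₀).tracePow_nonneg p₀)
    ((hR.sandwich S x₁).tracePow_nonneg p₁) hp₀' hp₁' hp hpp three

end Matrix

/-! ### Powers, supports and domination -/

namespace Matrix

section FunctionalCalculus

variable {n : Type*} [Fintype n] [DecidableEq n]

theorem IsHermitian.cfc_id_eq {A : Matrix n n ℂ} (hA : A.IsHermitian) :
    cfc (fun x : ℝ => x) A = A :=
  cfc_id' ℝ A hA.isSelfAdjoint

theorem cfc_one_eq (A : Matrix n n ℂ) (hA : A.IsHermitian) : cfc (fun _ : ℝ => (1 : ℝ)) A = 1 :=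
  cfc_const_one ℝ A hA.isSelfAdjoint

theorem IsHermitian.cfc_mulVec_eq_zero {A : Matrix n n ℂ} (hA : A.IsHermitian) (f g h : ℝ → ℝ)
    (hgf : ∀ i, g (hA.eigenvalues i) = h (hA.eigenvalues i) * f (hA.eigenvalues i))
    {v : n → ℂ} (hv : (cfc f A).mulVec v = 0) : (cfc g A).mulVec v = 0 := by
  rw [hA.cfc_congr_eigenvalues (g := fun x => h x * f x) hgf, ← hA.cfc_mul_cfc, ← mulVec_mulVec,
    hv, mulVec_zero]

theorem posSemidef_cfc {A : Matrix n n ℂ} (hA : A.IsHermitian) {f : ℝ → ℝ}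
    (hf : ∀ i, 0 ≤ f (hA.eigenvalues i)) : (cfc f A).PosSemidef := by
  have : cfc f A = (cfc (fun x => Real.sqrt (f x)) A)ᴴ * cfc (fun x => Real.sqrt (f x)) A := by
    rw [(IsHermitian.isHermitian_cfc A _).eq, hA.cfc_mul_cfc]
    exact hA.cfc_congr_eigenvalues fun i => (Real.mul_self_sqrt (hf i)).symm
  rw [this]
  exact posSemidef_conjTranspose_mul_self _

theorem matrixPow_zero {S : Matrix n n ℂ} (hS : S.IsHermitian) : matrixPow S 0 = 1 := by
  rw [matrixPow, ← cfc_one_eq S hS]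
  simp

theorem matrixPow_one {S : Matrix n n ℂ} (hS : S.IsHermitian) : matrixPow S 1 = S := by
  conv_rhs => rw [← hS.cfc_id_eq]
  simp [matrixPow]

theorem sandwich_zero {S : Matrix n n ℂ} (hS : S.IsHermitian) (R : Matrix n n ℂ) :
    sandwich S R 0 = R := by
  simp [sandwich, matrixPow_zero hS]

theorem PosSemidef.matrixPow_half_mul_self {S : Matrix n n ℂ} (hS : S.PosSemidef) (x : ℝ) :
    matrixPow S (x / 2) * matrixPow S (x / 2) = matrixPow S x := by
  rw [matrixPow, hS.isHermitian.cfc_mul_cfc, matrixPow]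
  refine hS.isHermitian.cfc_congr_eigenvalues fun i => ?_
  rcases (hS.eigenvalues_nonneg i).eq_or_lt with h | h
  · rw [← h]
    rcases eq_or_ne x 0 with rfl | hx
    · simp
    · rw [Real.zero_rpow (by positivity), Real.zero_rpow hx, mul_zero]
  · rw [← Real.rpow_add h, add_halves]

theorem PosSemidef.tracePow_pos {A : Matrix n n ℂ} (hA : A.PosSemidef) (h : A ≠ 0) (p : ℝ) :
    0 < A.tracePow p := by
  rw [hA.isHermitian.tracePow_eq_sum]
  have : ∃ i, hA.isHermitian.eigenvalues i ≠ 0 := by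
    by_contra! hc
    exact h (hA.isHermitian.eigenvalues_eq_zero_iff.mp (funext hc))
  obtain ⟨i, hi⟩ := this
  exact Finset.sum_pos' (fun j _ => Real.rpow_nonneg (hA.eigenvalues_nonneg j) _)
    ⟨i, Finset.mem_univ _, Real.rpow_pos_of_pos (lt_of_le_of_ne (hA.eigenvalues_nonneg i) hi.symm) _⟩

theorem sandwich_ne_zero {R S : Matrix n n ℂ} (hR : R.PosSemidef) (hS : S.PosSemidef)
    (h : R * S ≠ 0) (y : ℝ) : sandwich S R y ≠ 0 := by
  intro h0
  obtain ⟨T, rfl⟩ := hR.exists_eq_conjTranspose_mul_self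
  rw [sandwich_conjTranspose_mul_self, conjTranspose_mul_self_eq_zero] at h0
  apply h
  -- `S` is a right multiple of each of its powers, so `T S^(y/2) = 0` would force `T S = 0`; on the
  -- eigenvalue zero both sides vanish.
  have : S = matrixPow S (y / 2) * cfc (fun x : ℝ => x / x ^ (y / 2)) S := by
    rw [matrixPow, hS.isHermitian.cfc_mul_cfc]
    conv_lhs => rw [← hS.isHermitian.cfc_id_eq]
    refine hS.isHermitian.cfc_congr_eigenvalues fun i => ?_
    rcases (hS.eigenvalues_nonneg i).eq_or_lt with h | h
    · simp [← h]
    · have := Real.rpow_pos_of_pos h (y / 2)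
      field_simp
  rw [this, mul_assoc, ← mul_assoc T, h0]
  simp

/-- For `y ≠ 0` the outer power already annihilates the kernel of `S`. Only at `y = 0`, where `0 ^ 0
= 1` makes the power the identity, is domination of `R` itself needed. -/
theorem dominates_sandwich {R S : Matrix n n ℂ} (hS : S.PosSemidef) {y : ℝ}
    (h : y = 0 → Dominates S R) : Dominates S (sandwich S R y) := by
  rcases eq_or_ne y 0 with rfl | hy
  · rw [sandwich_zero hS.isHermitian]
    exact h rfl
  · intro v hv
    have : (matrixPow S (y / 2)).mulVec v = 0 := by
      refine hS.isHermitian.cfc_mulVec_eq_zero (fun x => x) _ (fun x => x ^ (y / 2) / x)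
        (fun i => ?_) (by rwa [hS.isHermitian.cfc_id_eq])
      rcases (hS.eigenvalues_nonneg i).eq_or_lt with h | h
      · rw [← h, Real.zero_rpow (by positivity), mul_zero]
      · field_simp
    rw [Matrix.sandwich, ← mulVec_mulVec, this, mulVec_zero]

/-- If `R S = 0`, then also `S R = 0`, so the range of `R` lies in the kernel of `S` and hence in
that of `R`; thus `R² = 0` and `R = 0`. -/
theorem Dominates.mul_ne_zero {R S : Matrix n n ℂ} (h : Dominates S R) (hR : R.PosSemidef)
    (hS : S.PosSemidef) (hR0 : R ≠ 0) : R * S ≠ 0 := by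
  intro h0
  have h1 : S * R = 0 := by
    rw [← hR.isHermitian.eq, ← hS.isHermitian.eq, ← conjTranspose_mul, h0, conjTranspose_zero]
  have h2 : R * R = 0 := by
    refine ext_of_mulVec_single fun i => ?_
    rw [← mulVec_mulVec, zero_mulVec]
    refine h _ ?_
    rw [mulVec_mulVec, h1, zero_mulVec]
  apply hR0
  rw [← conjTranspose_mul_self_eq_zero, hR.isHermitian.eq, h2]

/-- Convexity along lines in the `(x, 1 / p)`-plane of the logarithm of the Schatten norm of order
`p` of the sandwiched product with exponent `x`. -/
theorem log_tracePow_sandwich_convex {R S : Matrix n n ℂ} (hR : R.PosSemidef) (hS : S.PosSemidef)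
    (hRS : R * S ≠ 0) {p p₀ p₁ x₀ x₁ y : ℝ} (h0 : x₀ < y) (h1 : y < x₁)
    (hp₀ : 1 / 2 ≤ p₀) (hp₁ : 1 / 2 ≤ p₁) (hp : 0 < p)
    (hpp : (x₁ - x₀) * (1 / p) = (x₁ - y) * (1 / p₀) + (y - x₀) * (1 / p₁))
    (hdom : y = 0 → Dominates S R) :
    (x₁ - x₀) * (1 / p * Real.logb 2 ((sandwich S R y).tracePow p)) ≤
      (x₁ - y) * (1 / p₀ * Real.logb 2 ((sandwich S R x₀).tracePow p₀)) +
      (y - x₀) * (1 / p₁ * Real.logb 2 ((sandwich S R x₁).tracePow p₁)) := by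
  have hd : 0 < x₁ - x₀ := by linarith
  have hp₀' : 0 < p₀ := by linarith
  have hp₁' : 0 < p₁ := by linarith
  have pos : ∀ x q, 0 < (sandwich S R x).tracePow q := fun x q =>
    (hR.sandwich S x).tracePow_pos (sandwich_ne_zero hR hS hRS x) q
  have hθ : 1 - (y - x₀) / (x₁ - x₀) = (x₁ - y) / (x₁ - x₀) := by field_simp; ring
  have key := tracePow_sandwich_rpow_le hR hS (p := p) (p₀ := p₀) (p₁ := p₁) (x₀ := x₀) (x₁ := x₁)
    (y := y) (θ := (y - x₀) / (x₁ - x₀)) (by apply div_nonneg <;> linarith)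
    (by rw [div_le_one hd]; linarith) hp₀ hp₁ hp
    (by
      rw [hθ]
      have : 1 / p = ((x₁ - y) * (1 / p₀) + (y - x₀) * (1 / p₁)) / (x₁ - x₀) := by
        rw [← hpp]; field_simp
      rw [this]; field_simp)
    (by rw [hθ]; field_simp; ring) (dominates_sandwich hS hdom)
  rw [hθ] at key
  have h2 := (Real.logb_le_logb one_lt_two (Real.rpow_pos_of_pos (pos _ _) _)
    (mul_pos (Real.rpow_pos_of_pos (Real.rpow_pos_of_pos (pos _ _) _) _)
      (Real.rpow_pos_of_pos (Real.rpow_pos_of_pos (pos _ _) _) _))).mpr key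
  rw [Real.logb_mul (Real.rpow_pos_of_pos (Real.rpow_pos_of_pos (pos _ _) _) _).ne'
    (Real.rpow_pos_of_pos (Real.rpow_pos_of_pos (pos _ _) _) _).ne',
    Real.logb_rpow_eq_mul_logb_of_pos (Real.rpow_pos_of_pos (pos _ _) _),
    Real.logb_rpow_eq_mul_logb_of_pos (Real.rpow_pos_of_pos (pos _ _) _),
    Real.logb_rpow_eq_mul_logb_of_pos (pos _ _), Real.logb_rpow_eq_mul_logb_of_pos (pos _ _),
    Real.logb_rpow_eq_mul_logb_of_pos (pos _ _)] at h2
  have h3 := mul_le_mul_of_nonneg_left h2 hd.le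
  refine h3.trans (le_of_eq ?_)
  field_simp

end FunctionalCalculus

/-! ### Partial trace and the embedding of `σ` as `1 ⊗ σ` -/

section PartialTrace

variable {a b : Type*} [Fintype a]

theorem partialTraceLeft_posSemidef {ρ : Matrix (a × b) (a × b) ℂ} (hρ : ρ.PosSemidef) :
    (partialTraceLeft ρ).PosSemidef := by
  have : partialTraceLeft ρ = ∑ k : a, ρ.submatrix (fun i => (k, i)) (fun i => (k, i)) := by
    ext i j
    simp [partialTraceLeft, sum_apply]
  rw [this]
  exact posSemidef_sum _ fun k _ => hρ.submatrix _

variable [Fintype b]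

theorem isDensityMatrix_partialTraceLeft {ρ : Matrix (a × b) (a × b) ℂ} (hρ : IsDensityMatrix ρ) :
    IsDensityMatrix (partialTraceLeft ρ) := by
  refine ⟨partialTraceLeft_posSemidef hρ.posSemidef, ?_⟩
  rw [← hρ.trace_eq_one]
  simp only [trace, diag, partialTraceLeft, of_apply, Fintype.sum_prod_type]
  exact Finset.sum_comm

variable [DecidableEq a]

theorem trace_mul_one_kronecker (ρ : Matrix (a × b) (a × b) ℂ) (X : Matrix b b ℂ) :
    (ρ * ((1 : Matrix a a ℂ) ⊗ₖ X)).trace = (partialTraceLeft ρ * X).trace := by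
  simp only [trace, diag, mul_apply, partialTraceLeft, of_apply, Fintype.sum_prod_type,
    kroneckerMap_apply, one_apply, ite_mul, one_mul, zero_mul, mul_ite, mul_zero,
    Finset.sum_mul]
  rw [Finset.sum_comm]
  refine Finset.sum_congr rfl fun i _ => ?_
  rw [eq_comm, Finset.sum_comm]
  refine Finset.sum_congr rfl fun k _ => ?_
  rw [eq_comm, Finset.sum_comm]
  simp

theorem Dominates.partialTraceLeft {ρ : Matrix (a × b) (a × b) ℂ} {σ : Matrix b b ℂ}
    (h : Dominates ((1 : Matrix a a ℂ) ⊗ₖ σ) ρ) : Dominates σ (partialTraceLeft ρ) := by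
  intro w hw
  -- Test vectors `e_k ⊗ w` with `w` in the kernel of `σ`.
  have key : ∀ k : a, ρ.mulVec (fun p => if p.1 = k then w p.2 else 0) = 0 := fun k => by
    refine h _ (funext fun p => ?_)
    have := congrFun hw p.2
    change ∑ j, σ p.2 j * w j = 0 at this
    change ∑ q : a × b, ((1 : Matrix a a ℂ) ⊗ₖ σ) p q * (if q.1 = k then w q.2 else 0) = 0
    simp only [kroneckerMap_apply, Fintype.sum_prod_type, one_apply,
      ite_mul, one_mul, zero_mul, mul_ite, mul_zero]
    rw [Finset.sum_comm]
    simp only [Finset.sum_ite_eq', Finset.mem_univ, if_true]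
    by_cases hk : p.1 = k <;> simp [hk, this]
  funext i
  have : ∀ k : a, ∑ j, ρ (k, i) (k, j) * w j = 0 := fun k => by
    have := congrFun (key k) (k, i)
    simpa [mulVec, dotProduct, Fintype.sum_prod_type] using this
  simp only [mulVec, dotProduct, _root_.partialTraceLeft, of_apply, Finset.sum_mul, Pi.zero_apply]
  rw [Finset.sum_comm]
  exact Finset.sum_eq_zero fun k _ => this k

theorem posSemidef_one_kronecker {σ : Matrix b b ℂ} (hσ : σ.PosSemidef) :
    ((1 : Matrix a a ℂ) ⊗ₖ σ).PosSemidef :=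
  PosSemidef.one.kronecker hσ

variable [DecidableEq b]

/-- The star algebra homomorphism `X ↦ 1 ⊗ X`. -/
noncomputable def oneKroneckerHom (a : Type*) [Fintype a] [DecidableEq a] :
    Matrix b b ℂ →⋆ₐ[ℂ] Matrix (a × b) (a × b) ℂ where
  toFun X := (1 : Matrix a a ℂ) ⊗ₖ X
  map_one' := one_kronecker_one
  map_mul' X Y := by rw [← mul_kronecker_mul, one_mul]
  map_zero' := kronecker_zero _
  map_add' X Y := kronecker_add _ _ _
  commutes' r := by
    rw [Algebra.algebraMap_eq_smul_one, Algebra.algebraMap_eq_smul_one, kronecker_smul,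
      one_kronecker_one]
  map_star' X := by
    rw [star_eq_conjTranspose, star_eq_conjTranspose, conjTranspose_kronecker, conjTranspose_one]

theorem cfc_one_kronecker {σ : Matrix b b ℂ} (hσ : σ.IsHermitian) (f : ℝ → ℝ) :
    cfc f ((1 : Matrix a a ℂ) ⊗ₖ σ) = (1 : Matrix a a ℂ) ⊗ₖ cfc f σ := by
  have h := StarAlgHom.map_cfc (oneKroneckerHom (b := b) a) f σ
    ((finite_real_spectrum (A := σ)).continuousOn _)
    (by
      refine continuous_matrix fun i j => ?_
      change Continuous fun X : Matrix b b ℂ => (1 : Matrix a a ℂ) i.1 j.1 * X i.2 j.2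
      fun_prop)
    hσ.isSelfAdjoint ((hσ.isSelfAdjoint).map (oneKroneckerHom (b := b) a))
  exact h.symm

theorem matrixPow_one_kronecker {σ : Matrix b b ℂ} (hσ : σ.IsHermitian) (x : ℝ) :
    matrixPow ((1 : Matrix a a ℂ) ⊗ₖ σ) x = (1 : Matrix a a ℂ) ⊗ₖ matrixPow σ x :=
  cfc_one_kronecker hσ _

theorem matrixLog_one_kronecker {σ : Matrix b b ℂ} (hσ : σ.IsHermitian) :
    matrixLog ((1 : Matrix a a ℂ) ⊗ₖ σ) = (1 : Matrix a a ℂ) ⊗ₖ matrixLog σ :=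
  cfc_one_kronecker hσ _

/-- At order one the trace is linear in `ρ`, and cyclicity collects both powers of `1 ⊗ σ` on one
side; this is how the marginal enters the interpolation. -/
theorem tracePow_one_sandwich_one_kronecker {ρ : Matrix (a × b) (a × b) ℂ} (hρ : ρ.PosSemidef)
    {σ : Matrix b b ℂ} (hσ : σ.PosSemidef) (x : ℝ) :
    (sandwich ((1 : Matrix a a ℂ) ⊗ₖ σ) ρ x).tracePow 1 =
      (partialTraceLeft ρ * matrixPow σ x).trace.re := by
  rw [tracePow, matrixPow_one (hρ.sandwich _ _).isHermitian, sandwich, trace_mul_comm, ← mul_assoc,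
    (posSemidef_one_kronecker hσ).matrixPow_half_mul_self, trace_mul_comm,
    matrixPow_one_kronecker hσ.isHermitian, trace_mul_one_kronecker]

/-- With `q` the projection onto the kernel of `σ`, `tr (ρ (1 ⊗ q)) = tr (ρ_B q) = 0`, and
positivity of `ρ` upgrades this to `ρ (1 ⊗ q) = 0`. -/
theorem Dominates.of_partialTraceLeft {ρ : Matrix (a × b) (a × b) ℂ} (hρ : ρ.PosSemidef)
    {σ : Matrix b b ℂ} (hσ : σ.PosSemidef) (h : Dominates σ (_root_.partialTraceLeft ρ)) :
    Dominates ((1 : Matrix a a ℂ) ⊗ₖ σ) ρ := by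
  set q : ℝ → ℝ := fun x => if x = 0 then 1 else 0 with hq
  have hS := posSemidef_one_kronecker (a := a) hσ
  have h1 : σ * cfc q σ = 0 := by
    conv_lhs => enter [1]; rw [← hσ.isHermitian.cfc_id_eq]
    rw [hσ.isHermitian.cfc_mul_cfc, hσ.isHermitian.cfc_congr_eigenvalues (g := fun _ => 0)
      (fun i => by simp [hq]), cfc_const_zero]
  have h2 : _root_.partialTraceLeft ρ * cfc q σ = 0 := by
    refine ext_of_mulVec_single fun i => ?_
    rw [← mulVec_mulVec, zero_mulVec]
    refine h _ ?_
    rw [mulVec_mulVec, h1, zero_mulVec]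
  have h3 : (1 : Matrix a a ℂ) ⊗ₖ cfc q σ = cfc q ((1 : Matrix a a ℂ) ⊗ₖ σ) :=
    (cfc_one_kronecker hσ.isHermitian q).symm
  set S := (1 : Matrix a a ℂ) ⊗ₖ σ with hSdef
  obtain ⟨T, hT⟩ := hρ.exists_eq_conjTranspose_mul_self
  have h4 : T * cfc q S = 0 := by
    rw [← trace_conjTranspose_mul_self_eq_zero_iff, conjTranspose_mul,
      (IsHermitian.isHermitian_cfc S q).eq, trace_mul_comm, mul_assoc, ← mul_assoc (cfc q S),
      hS.isHermitian.cfc_mul_cfc,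
      hS.isHermitian.cfc_congr_eigenvalues (g := q) (fun i => by simp [hq]), trace_mul_comm,
      mul_assoc, trace_mul_comm, ← hT, ← h3, trace_mul_one_kronecker, h2, trace_zero]
  have h5 : ρ * cfc q S = 0 := by rw [hT, mul_assoc, h4, mul_zero]
  intro v hv
  have h6 : (cfc q S).mulVec v = v := by
    have e : cfc q S + cfc (fun x : ℝ => x⁻¹) S * S = 1 := by
      apply eq_of_op_eq hS.isHermitian.eigenvectorBasis
      intro i
      simp only [map_add, _root_.map_one, _root_.add_apply, op_mul_apply,
        hS.isHermitian.op_cfc_apply, hS.isHermitian.op_apply, map_smul, smul_smul, ← add_smul]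
      simp only [hq]
      split_ifs with h0
      · simp [h0]
      · simp [h0]
    have := congrArg (fun M => M.mulVec v) e
    simpa [add_mulVec, ← mulVec_mulVec, hv] using this
  rw [← h6, mulVec_mulVec, h5, zero_mulVec]

end PartialTrace

end Matrix

/-! ### Overlaps of two eigenbases -/

namespace Matrix

variable {n : Type*} [Fintype n] [DecidableEq n]

section Overlap

variable {A B : Matrix n n ℂ} (hA : A.IsHermitian) (hB : B.IsHermitian)

/-- The squared overlaps of the eigenvectors of two Hermitian matrices. -/
noncomputable def overlap (i j : n) : ℝ :=
  ‖inner ℂ (hA.eigenvectorBasis i) (hB.eigenvectorBasis j)‖ ^ 2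

theorem overlap_nonneg (i j : n) : 0 ≤ overlap hA hB i j := sq_nonneg _

theorem sum_overlap_right (i : n) : ∑ j, overlap hA hB i j = 1 := by
  simp only [overlap]
  rw [hB.eigenvectorBasis.sum_sq_norm_inner_left, hA.eigenvectorBasis.orthonormal.1, one_pow]

theorem sum_overlap_left (j : n) : ∑ i, overlap hA hB i j = 1 := by
  simp only [overlap]
  rw [hA.eigenvectorBasis.sum_sq_norm_inner_right, hB.eigenvectorBasis.orthonormal.1, one_pow]

theorem re_trace_mul_cfc_eq_sum_overlap (g : ℝ → ℝ) :
    (A * cfc g B).trace.re =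
      ∑ k : n × n, overlap hA hB k.1 k.2 * (hA.eigenvalues k.1 * g (hB.eigenvalues k.2)) := by
  have := hA.re_trace_cfc_mul_cfc hB (fun x => x) g
  rw [hA.cfc_id_eq] at this
  rw [this, Fintype.sum_prod_type]
  rfl

theorem sum_overlap_mul_left (f : n → ℝ) :
    ∑ k : n × n, overlap hA hB k.1 k.2 * f k.1 = ∑ i, f i := by
  rw [Fintype.sum_prod_type]
  refine Finset.sum_congr rfl fun i _ => ?_
  dsimp only
  rw [← Finset.sum_mul, sum_overlap_right, one_mul]

theorem sum_overlap_mul_right (f : n → ℝ) :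
    ∑ k : n × n, overlap hA hB k.1 k.2 * f k.2 = ∑ j, f j := by
  rw [Fintype.sum_prod_type_right]
  refine Finset.sum_congr rfl fun i _ => ?_
  dsimp only
  rw [← Finset.sum_mul, sum_overlap_left, one_mul]

/-- This discards the terms at zero eigenvalues of `B`, where negative powers and logarithms take
default values. It holds because `A` kills the `j`-th eigenvector of `B`. -/
theorem overlap_mul_eigenvalues_eq_zero (h : Dominates B A) {j : n} (hj : hB.eigenvalues j = 0)
    (i : n) : overlap hA hB i j * hA.eigenvalues i = 0 := by
  have h1 : A.op (hB.eigenvectorBasis j) = 0 := by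
    have := h (hB.eigenvectorBasis j).ofLp (by
      rw [mulVec_eq_zero_iff_op]
      change B.op (hB.eigenvectorBasis j) = 0
      rw [hB.op_apply, hj]
      simp)
    rw [mulVec_eq_zero_iff_op] at this
    exact this
  have h2 : inner ℂ (A.op (hA.eigenvectorBasis i)) (hB.eigenvectorBasis j) = 0 := by
    rw [inner_op_left_of_isHermitian hA, h1, inner_zero_right]
  rw [hA.op_apply, inner_smul_left, Complex.conj_ofReal] at h2
  rcases mul_eq_zero.mp h2 with h3 | h3
  · rw [show hA.eigenvalues i = 0 by exact_mod_cast h3, mul_zero]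
  · rw [overlap, h3]
    simp

end Overlap

end Matrix

open Matrix Filter Topology

/-! ### Variational bounds for a pair of states -/

section Density

variable {n : Type*} [Fintype n]

theorem IsDensityMatrix.ne_zero {ρ : Matrix n n ℂ} (hρ : IsDensityMatrix ρ) : ρ ≠ 0 := by
  rintro rfl
  simpa using hρ.trace_eq_one

variable [DecidableEq n]

theorem IsDensityMatrix.sum_eigenvalues {ρ : Matrix n n ℂ} (hρ : IsDensityMatrix ρ) :
    ∑ i, hρ.posSemidef.isHermitian.eigenvalues i = 1 := by
  have := hρ.posSemidef.isHermitian.trace_eq_sum_eigenvalues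
  rw [hρ.trace_eq_one] at this
  have := congrArg Complex.re this
  simpa using this.symm

theorem IsDensityMatrix.tracePow_pos {ρ : Matrix n n ℂ} (hρ : IsDensityMatrix ρ) (p : ℝ) :
    0 < ρ.tracePow p :=
  hρ.posSemidef.tracePow_pos hρ.ne_zero p

/-- Hölder's inequality `tr (τ σ ^ (1 - 1 / γ)) ≤ ‖τ‖_γ` for `γ > 1`. -/
theorem re_trace_mul_matrixPow_le {τ σ : Matrix n n ℂ} (hτ : IsDensityMatrix τ)
    (hσ : IsDensityMatrix σ) {γ : ℝ} (hγ : 1 < γ) :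
    (τ * matrixPow σ (1 - 1 / γ)).trace.re ≤ τ.tracePow γ ^ (1 / γ) := by
  have hγ0 : 0 < γ := by linarith
  rw [matrixPow, re_trace_mul_cfc_eq_sum_overlap hτ.posSemidef.isHermitian
    hσ.posSemidef.isHermitian, hτ.posSemidef.isHermitian.tracePow_eq_sum]
  set r := hτ.posSemidef.isHermitian.eigenvalues with hr
  set s := hσ.posSemidef.isHermitian.eigenvalues with hs
  have hr0 : ∀ i, 0 ≤ r i := hτ.posSemidef.eigenvalues_nonneg
  have hs0 : ∀ i, 0 ≤ s i := hσ.posSemidef.eigenvalues_nonneg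
  have key := sum_mul_rpow_mul_rpow_le Finset.univ (fun k : n × n =>
    overlap hτ.posSemidef.isHermitian hσ.posSemidef.isHermitian k.1 k.2) (fun k => r k.1 ^ γ)
    (fun k => s k.2) (fun k => overlap_nonneg _ _ _ _) (fun k => Real.rpow_nonneg (hr0 _) _)
    (fun k => hs0 _) (θ := 1 / γ) (by positivity) (by rw [div_le_one hγ0]; exact hγ.le)
  rw [sum_overlap_mul_left (f := fun i => r i ^ γ), sum_overlap_mul_right, hs, hσ.sum_eigenvalues,
    Real.one_rpow, mul_one] at key
  refine le_trans (le_of_eq (Finset.sum_congr rfl fun k _ => ?_)) key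
  rw [← Real.rpow_mul (hr0 _), mul_one_div_cancel hγ0.ne', Real.rpow_one]

/-- The reverse Hölder inequality `‖τ‖_γ ≤ tr (τ σ ^ (1 - 1 / γ))` for `γ < 1`. -/
theorem le_re_trace_mul_matrixPow {τ σ : Matrix n n ℂ} (hτ : IsDensityMatrix τ)
    (hσ : IsDensityMatrix σ) (h : Dominates σ τ) {γ : ℝ} (hγ0 : 0 < γ) (hγ : γ < 1) :
    τ.tracePow γ ^ (1 / γ) ≤ (τ * matrixPow σ (1 - 1 / γ)).trace.re := by
  set r := hτ.posSemidef.isHermitian.eigenvalues with hr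
  set s := hσ.posSemidef.isHermitian.eigenvalues with hs
  have hr0 : ∀ i, 0 ≤ r i := hτ.posSemidef.eigenvalues_nonneg
  have hs0 : ∀ i, 0 ≤ s i := hσ.posSemidef.eigenvalues_nonneg
  have hD0 : ∀ i j, 0 ≤ overlap hτ.posSemidef.isHermitian hσ.posSemidef.isHermitian i j :=
    overlap_nonneg _ _
  -- With exponent `γ` on `r * s ^ (1 - 1 / γ)` and `1 - γ` on `s`, the powers of `s` cancel and `r
  -- ^ γ` remains.
  have key := sum_mul_rpow_mul_rpow_le Finset.univ (fun k : n × n =>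
    overlap hτ.posSemidef.isHermitian hσ.posSemidef.isHermitian k.1 k.2)
    (fun k => r k.1 * s k.2 ^ (1 - 1 / γ))
    (fun k => s k.2) (fun k => hD0 _ _)
    (fun k => mul_nonneg (hr0 _) (Real.rpow_nonneg (hs0 _) _))
    (fun k => hs0 _) hγ0.le hγ.le
  rw [sum_overlap_mul_right, hs, hσ.sum_eigenvalues, Real.one_rpow, mul_one, ← hs] at key
  have hsum : 0 ≤ ∑ k : n × n, overlap hτ.posSemidef.isHermitian hσ.posSemidef.isHermitian k.1 k.2 *
      (r k.1 * s k.2 ^ (1 - 1 / γ)) := Finset.sum_nonneg fun k _ =>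
        mul_nonneg (hD0 _ _) (mul_nonneg (hr0 _) (Real.rpow_nonneg (hs0 _) _))
  have hle : τ.tracePow γ ≤ (∑ k : n × n,
      overlap hτ.posSemidef.isHermitian hσ.posSemidef.isHermitian k.1 k.2 *
      (r k.1 * s k.2 ^ (1 - 1 / γ))) ^ γ := by
    refine le_trans (le_of_eq ?_) key
    rw [hτ.posSemidef.isHermitian.tracePow_eq_sum, ← sum_overlap_mul_left
      hτ.posSemidef.isHermitian hσ.posSemidef.isHermitian (f := fun i => r i ^ γ)]
    refine Finset.sum_congr rfl fun k _ => ?_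
    rcases (hs0 k.2).eq_or_lt with h0 | h0
    · rcases mul_eq_zero.mp (overlap_mul_eigenvalues_eq_zero hτ.posSemidef.isHermitian
        hσ.posSemidef.isHermitian h h0.symm k.1) with h1 | h1
      · rw [h1, zero_mul, zero_mul]
      · have : r k.1 = 0 := h1
        simp [this, Real.zero_rpow hγ0.ne']
    · rw [Real.mul_rpow (hr0 _) (Real.rpow_nonneg (hs0 _) _), ← Real.rpow_mul (hs0 _), mul_assoc,
        ← Real.rpow_add h0, show (1 - 1 / γ) * γ + (1 - γ) = 0 by field_simp; ring,
        Real.rpow_zero, mul_one]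
  rw [matrixPow, re_trace_mul_cfc_eq_sum_overlap hτ.posSemidef.isHermitian
    hσ.posSemidef.isHermitian]
  have := Real.rpow_le_rpow (hτ.tracePow_pos γ).le hle (z := 1 / γ) (by positivity)
  rwa [← Real.rpow_mul hsum, mul_one_div_cancel hγ0.ne', Real.rpow_one] at this

/-- Jensen's inequality `v tr (τ log σ) ≤ log tr (τ σ ^ v)`. -/
theorem mul_re_trace_mul_matrixLog_le {τ σ : Matrix n n ℂ} (hτ : IsDensityMatrix τ)
    (hσ : IsDensityMatrix σ) (h : Dominates σ τ) (v : ℝ) :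
    v * (τ * matrixLog σ).trace.re ≤ Real.logb 2 (τ * matrixPow σ v).trace.re := by
  rw [matrixPow, matrixLog, re_trace_mul_cfc_eq_sum_overlap hτ.posSemidef.isHermitian
    hσ.posSemidef.isHermitian, re_trace_mul_cfc_eq_sum_overlap hτ.posSemidef.isHermitian
    hσ.posSemidef.isHermitian]
  set D := overlap hτ.posSemidef.isHermitian hσ.posSemidef.isHermitian with hD
  set r := hτ.posSemidef.isHermitian.eigenvalues with hr
  set s := hσ.posSemidef.isHermitian.eigenvalues with hs
  have hr0 : ∀ i, 0 ≤ r i := hτ.posSemidef.eigenvalues_nonneg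
  have hs0 : ∀ i, 0 ≤ s i := hσ.posSemidef.eigenvalues_nonneg
  have hD0 : ∀ i j, 0 ≤ D i j := overlap_nonneg _ _
  have hW0 : ∀ k : n × n, 0 ≤ D k.1 k.2 * r k.1 := fun k => mul_nonneg (hD0 _ _) (hr0 _)
  have hW1 : ∑ k : n × n, D k.1 k.2 * r k.1 = 1 := by
    rw [sum_overlap_mul_left, hr, hτ.sum_eigenvalues]
  have hWs : ∀ k : n × n, D k.1 k.2 * r k.1 ≠ 0 → 0 < s k.2 := fun k hk =>
    lt_of_le_of_ne (hs0 _) fun h0 => hk (overlap_mul_eigenvalues_eq_zero _ _ h h0.symm _)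
  set c := ∑ k : n × n, D k.1 k.2 * (r k.1 * s k.2 ^ v) with hc
  have hc0 : 0 < c := by
    obtain ⟨k, -, hk⟩ : ∃ k ∈ (Finset.univ : Finset (n × n)), D k.1 k.2 * r k.1 ≠ 0 := by
      apply Finset.exists_ne_zero_of_sum_ne_zero
      rw [hW1]
      exact one_ne_zero
    refine Finset.sum_pos' (fun k _ => mul_nonneg (hD0 _ _)
      (mul_nonneg (hr0 _) (Real.rpow_nonneg (hs0 _) _))) ⟨k, Finset.mem_univ _, ?_⟩
    rw [← mul_assoc]
    exact mul_pos (lt_of_le_of_ne (hW0 k) hk.symm) (Real.rpow_pos_of_pos (hWs k hk) _)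
  have hlog2 : 0 < Real.log 2 := Real.log_pos one_lt_two
  -- Jensen via `log z ≤ z - 1` at `z = s ^ v / c`, averaged over the probability weights `D * r`;
  -- the normalisation `c` makes the right side vanish.
  have key : ∑ k : n × n, D k.1 k.2 * r k.1 * (v * Real.log (s k.2) - Real.log c) ≤
      ∑ k : n × n, D k.1 k.2 * r k.1 * (s k.2 ^ v / c - 1) := by
    refine Finset.sum_le_sum fun k _ => ?_
    by_cases hk : D k.1 k.2 * r k.1 = 0
    · rw [hk, zero_mul, zero_mul]
    · refine mul_le_mul_of_nonneg_left ?_ (hW0 k)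
      have hsk := hWs k hk
      rw [← Real.log_rpow hsk, ← Real.log_div (Real.rpow_pos_of_pos hsk _).ne' hc0.ne']
      exact Real.log_le_sub_one_of_pos (div_pos (Real.rpow_pos_of_pos hsk _) hc0)
  have e1 : ∑ k : n × n, D k.1 k.2 * r k.1 * (s k.2 ^ v / c - 1) = 0 := by
    have : ∀ k : n × n, D k.1 k.2 * r k.1 * (s k.2 ^ v / c - 1) =
        D k.1 k.2 * (r k.1 * s k.2 ^ v) / c - D k.1 k.2 * r k.1 := fun k => by ring
    simp only [this]
    rw [Finset.sum_sub_distrib, ← Finset.sum_div, hW1, ← hc, div_self hc0.ne', sub_self]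
  have e2 : ∑ k : n × n, D k.1 k.2 * r k.1 * (v * Real.log (s k.2) - Real.log c) =
      v * (∑ k : n × n, D k.1 k.2 * (r k.1 * Real.logb 2 (s k.2))) * Real.log 2 - Real.log c := by
    have : ∀ k : n × n, D k.1 k.2 * r k.1 * (v * Real.log (s k.2) - Real.log c) =
        v * (D k.1 k.2 * (r k.1 * Real.logb 2 (s k.2))) * Real.log 2 -
          D k.1 k.2 * r k.1 * Real.log c := fun k => by
      rw [Real.logb]
      field_simp
    simp only [this]
    rw [Finset.sum_sub_distrib, ← Finset.sum_mul, ← Finset.sum_mul, ← Finset.mul_sum, hW1, one_mul]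
  rw [e1, e2] at key
  rw [Real.logb, le_div_iff₀ hlog2]
  linarith

/-- The state with density proportional to `ρ ^ γ`. -/
noncomputable def tilted (ρ : Matrix n n ℂ) (γ : ℝ) :
    Matrix n n ℂ :=
  cfc (fun x : ℝ => (ρ.tracePow γ)⁻¹ * x ^ γ) ρ

theorem isDensityMatrix_tilted {ρ : Matrix n n ℂ} (hρ : IsDensityMatrix ρ) (γ : ℝ) :
    IsDensityMatrix (tilted ρ γ) := by
  have hN := hρ.tracePow_pos γ
  refine ⟨posSemidef_cfc hρ.posSemidef.isHermitian fun i => mul_nonneg (inv_nonneg.2 hN.le)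
    (Real.rpow_nonneg (hρ.posSemidef.eigenvalues_nonneg i) _), ?_⟩
  rw [tilted, hρ.posSemidef.isHermitian.trace_cfc, ← Complex.ofReal_sum, ← Finset.mul_sum,
    ← hρ.posSemidef.isHermitian.tracePow_eq_sum, inv_mul_cancel₀ hN.ne', Complex.ofReal_one]

theorem dominates_tilted {ρ : Matrix n n ℂ} (hρ : IsDensityMatrix ρ) (γ : ℝ) :
    Dominates (tilted ρ γ) ρ := by
  have hN := hρ.tracePow_pos γ
  intro v hv
  have := hρ.posSemidef.isHermitian.cfc_mulVec_eq_zero _ (fun x => x)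
    (fun x => x * (ρ.tracePow γ * (x ^ γ)⁻¹)) (fun i => ?_) hv
  · rwa [hρ.posSemidef.isHermitian.cfc_id_eq] at this
  · rcases (hρ.posSemidef.eigenvalues_nonneg i).eq_or_lt with h | h
    · simp [← h]
    · have := Real.rpow_pos_of_pos h γ
      field_simp

/-- Equality in Hölder: `ρ` commutes with its tilted state, and `1 + γ (1 - 1 / γ) = γ` turns the
product into a multiple of `ρ ^ γ`. -/
theorem re_trace_mul_matrixPow_tilted {ρ : Matrix n n ℂ} (hρ : IsDensityMatrix ρ) {γ : ℝ}
    (hγ : γ ≠ 0) :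
    (ρ * matrixPow (tilted ρ γ) (1 - 1 / γ)).trace.re = ρ.tracePow γ ^ (1 / γ) := by
  have hN := hρ.tracePow_pos γ
  set N := ρ.tracePow γ with hNdef
  have hH := hρ.posSemidef.isHermitian
  have e : ρ * matrixPow (tilted ρ γ) (1 - 1 / γ) =
      cfc (fun x : ℝ => N ^ (1 / γ - 1) * x ^ γ) ρ := by
    rw [matrixPow, tilted, hH.cfc_cfc]
    conv_lhs => enter [1]; rw [← hH.cfc_id_eq]
    rw [hH.cfc_mul_cfc]
    refine hH.cfc_congr_eigenvalues fun i => ?_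
    rcases (hρ.posSemidef.eigenvalues_nonneg i).eq_or_lt with h | h
    · simp [← h, Real.zero_rpow hγ]
    · have h1 : (hH.eigenvalues i) * (hH.eigenvalues i) ^ (γ * (1 - 1 / γ)) =
          (hH.eigenvalues i) ^ γ := by
        nth_rewrite 1 [← Real.rpow_one (hH.eigenvalues i)]
        rw [← Real.rpow_add h]
        congr 1
        field_simp
        ring
      rw [Real.mul_rpow (inv_nonneg.2 hN.le) (Real.rpow_nonneg h.le _), ← Real.rpow_mul h.le,
        Real.inv_rpow hN.le, ← Real.rpow_neg hN.le, neg_sub, ← h1]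
      ring
  rw [e, hH.re_trace_cfc, ← Finset.mul_sum, ← hH.tracePow_eq_sum, ← hNdef]
  nth_rewrite 2 [← Real.rpow_one N]
  rw [← Real.rpow_add hN]
  congr 1
  ring

end Density

/-! ### Continuity of the entropy in its order -/

section Continuity

variable {n : Type*} [Fintype n] [DecidableEq n] {ρ : Matrix n n ℂ}

theorem renyiEntropy_of_ne {α : ℝ} (h0 : α ≠ 0) (h1 : α ≠ 1) (ρ : Matrix n n ℂ) :
    renyiEntropy α ρ = 1 / (1 - α) * Real.logb 2 (ρ.tracePow α) := by
  rw [renyiEntropy, if_neg h0, if_neg h1, tracePow]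

theorem Matrix.IsHermitian.renyiEntropy_one (hρ : ρ.IsHermitian) :
    renyiEntropy 1 ρ = -∑ i, hρ.eigenvalues i * Real.logb 2 (hρ.eigenvalues i) := by
  rw [renyiEntropy, if_neg one_ne_zero, if_pos rfl]
  have : ρ * matrixLog ρ = cfc (fun x : ℝ => x * Real.logb 2 x) ρ := by
    rw [matrixLog]
    conv_lhs => enter [1]; rw [← hρ.cfc_id_eq]
    rw [hρ.cfc_mul_cfc]
  rw [this, hρ.re_trace_cfc]

theorem Matrix.IsHermitian.continuousAt_tracePow (hρ : ρ.IsHermitian) {α : ℝ} (h : α ≠ 0) :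
    ContinuousAt (fun x => ρ.tracePow x) α := by
  simp only [hρ.tracePow_eq_sum]
  exact tendsto_finsetSum _ fun i _ => Real.continuousAt_const_rpow' h

theorem hasDerivAt_const_rpow_one {r : ℝ} (hr : 0 ≤ r) :
    HasDerivAt (fun x : ℝ => r ^ x) (r * Real.log r) 1 := by
  rcases hr.eq_or_lt with rfl | hr
  · rw [zero_mul]
    refine (hasDerivAt_const (1 : ℝ) (0 : ℝ)).congr_of_eventuallyEq ?_
    filter_upwards [eventually_ne_nhds (one_ne_zero (α := ℝ))] with x hx
    rw [Real.zero_rpow hx]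
  · simpa using (Real.hasStrictDerivAt_const_rpow hr 1).hasDerivAt

theorem IsDensityMatrix.tracePow_one (hρ : IsDensityMatrix ρ) : ρ.tracePow 1 = 1 := by
  rw [tracePow, matrixPow_one hρ.posSemidef.isHermitian, hρ.trace_eq_one, Complex.one_re]

theorem continuousAt_renyiEntropy (hρ : IsDensityMatrix ρ) {α : ℝ} (h : 0 < α) :
    ContinuousAt (fun x => renyiEntropy x ρ) α := by
  have hH := hρ.posSemidef.isHermitian
  rcases eq_or_ne α 1 with rfl | h1
  -- Near order one, `H_x` is minus the slope between `1` and `x` of `x ↦ log tr ρ ^ x`, which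
  -- vanishes at `1`; the limit is minus the derivative, the von Neumann entropy.
  · rw [continuousAt_iff_punctured_nhds]
    have hr0 := hρ.posSemidef.eigenvalues_nonneg
    have hd : HasDerivAt (fun x => Real.logb 2 (ρ.tracePow x))
        (∑ i, hH.eigenvalues i * Real.logb 2 (hH.eigenvalues i)) 1 := by
      have hs : HasDerivAt (fun x => ρ.tracePow x)
          (∑ i, hH.eigenvalues i * Real.log (hH.eigenvalues i)) 1 := by
        simp only [hH.tracePow_eq_sum]
        exact HasDerivAt.fun_sum fun i _ => hasDerivAt_const_rpow_one (hr0 i)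
      have := (hs.log (by rw [hρ.tracePow_one]; exact one_ne_zero)).div_const (Real.log 2)
      rw [hρ.tracePow_one, div_one, Finset.sum_div] at this
      simpa only [Real.logb, mul_div_assoc] using this
    have hs := hasDerivAt_iff_tendsto_slope.mp hd
    rw [hH.renyiEntropy_one]
    refine hs.neg.congr' ?_
    filter_upwards [self_mem_nhdsWithin,
      nhdsWithin_le_nhds (eventually_ne_nhds (one_ne_zero (α := ℝ)))] with x hx hx0
    have hx1 : x ≠ 1 := hx
    rw [renyiEntropy_of_ne hx0 hx1, slope_def_field, hρ.tracePow_one, Real.logb_one, sub_zero]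
    have h2 : x - 1 ≠ 0 := sub_ne_zero.2 hx1
    have h3 : 1 - x ≠ 0 := sub_ne_zero.2 hx1.symm
    field_simp
    ring
  · have hc : ContinuousAt (fun x => 1 / (1 - x) * Real.logb 2 (ρ.tracePow x)) α := by
      refine ContinuousAt.mul ?_ ?_
      · exact ContinuousAt.div continuousAt_const (by fun_prop) (sub_ne_zero.2 h1.symm)
      · exact ContinuousAt.div_const
          ((hH.continuousAt_tracePow h.ne').log (hρ.tracePow_pos α).ne') _
    refine hc.congr ?_
    filter_upwards [eventually_ne_nhds h.ne', eventually_ne_nhds h1] with x hx0 hx1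
    rw [renyiEntropy_of_ne hx0 hx1]

/-- For `x > 0` zero eigenvalues contribute nothing, so the trace tends to the rank. The value of
`tracePow` at `0` itself would count the full dimension, since `0 ^ 0 = 1`. -/
theorem tendsto_renyiEntropy_zero (hρ : IsDensityMatrix ρ) :
    Tendsto (fun x => renyiEntropy x ρ) (𝓝[>] 0) (𝓝 (renyiEntropy 0 ρ)) := by
  have hH := hρ.posSemidef.isHermitian
  have hr : (ρ.rank : ℝ) = ∑ i, if hH.eigenvalues i = 0 then (0 : ℝ) else 1 := by
    rw [hH.rank_eq_card_non_zero_eigs, Fintype.card_subtype, Finset.card_filter]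
    push_cast
    exact Finset.sum_congr rfl fun i _ => by split_ifs <;> simp_all
  have ht : Tendsto (fun x => ρ.tracePow x) (𝓝[>] 0) (𝓝 (ρ.rank : ℝ)) := by
    rw [hr]
    simp only [hH.tracePow_eq_sum]
    refine tendsto_finsetSum _ fun i _ => ?_
    split_ifs with h
    · refine tendsto_const_nhds.congr' ?_
      filter_upwards [self_mem_nhdsWithin] with x hx
      rw [h, Real.zero_rpow (ne_of_gt hx)]
    · have := (Real.continuousAt_const_rpow h (b := 0)).tendsto
      rw [Real.rpow_zero] at this
      exact this.mono_left nhdsWithin_le_nhds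
  have hpos : (ρ.rank : ℝ) ≠ 0 := by
    rw [Nat.cast_ne_zero]
    intro h0
    rw [hH.rank_eq_card_non_zero_eigs, Fintype.card_eq_zero_iff] at h0
    exact hρ.ne_zero (hH.eigenvalues_eq_zero_iff.mp (funext fun i => by
      by_contra hi
      exact h0.false ⟨i, hi⟩))
  have e : renyiEntropy 0 ρ = 1 / (1 - 0) * Real.logb 2 (ρ.rank : ℝ) := by
    simp [renyiEntropy]
  rw [e]
  have hc : Tendsto (fun x : ℝ => 1 / (1 - x)) (𝓝[>] 0) (𝓝 (1 / (1 - 0))) := by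
    have : ContinuousAt (fun x : ℝ => 1 / (1 - x)) 0 :=
      ContinuousAt.div continuousAt_const (by fun_prop) (by norm_num)
    exact this.tendsto.mono_left nhdsWithin_le_nhds
  refine (hc.mul ((ht.log hpos).div_const _)).congr' ?_
  filter_upwards [self_mem_nhdsWithin,
    nhdsWithin_le_nhds (eventually_ne_nhds (zero_ne_one (α := ℝ)))] with x hx hx1
  rw [renyiEntropy_of_ne (ne_of_gt hx) hx1, Real.logb]

end Continuity

/-! ### Divergences and the sign of the interpolation -/

section Divergence

variable {n : Type*} [Fintype n] [DecidableEq n]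

theorem renyiDivergence_of_ne_one {β : ℝ} (hβ0 : 0 < β) (hβ : β ≠ 1) {R S : Matrix n n ℂ}
    (h : R * S ≠ 0) (h' : Dominates S R ∨ β < 1) :
    renyiDivergence β R S =
      ((1 / (β - 1) * Real.logb 2 ((sandwich S R (1 / β - 1)).tracePow β) : ℝ) : EReal) := by
  rw [renyiDivergence, if_neg hβ, if_pos ⟨h, h'⟩, sandwich, tracePow,
    show (1 / β - 1) / 2 = (1 - β) / (2 * β) by field_simp]

variable {a b : Type*} [Fintype a] [DecidableEq a] [Fintype b] [DecidableEq b]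

theorem renyiDivergence_one_one_kronecker {ρ : Matrix (a × b) (a × b) ℂ} {σ : Matrix b b ℂ}
    (hσ : σ.IsHermitian) (h : Dominates ((1 : Matrix a a ℂ) ⊗ₖ σ) ρ) :
    renyiDivergence 1 ρ ((1 : Matrix a a ℂ) ⊗ₖ σ) =
      ((-renyiEntropy 1 ρ - (partialTraceLeft ρ * matrixLog σ).trace.re : ℝ) : EReal) := by
  rw [renyiDivergence, if_pos rfl, if_pos h, renyiEntropy, if_neg one_ne_zero, if_pos rfl,
    matrixLog_one_kronecker hσ, mul_sub, trace_sub, trace_mul_one_kronecker, Complex.sub_re,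
    neg_neg]

theorem condRenyiEntropyUp_add_le {β : ℝ} {ρ : Matrix (a × b) (a × b) ℂ} {x y : ℝ}
    (h : ∀ σ : Matrix b b ℂ, IsDensityMatrix σ →
      ((x - y : ℝ) : EReal) ≤ renyiDivergence β ρ ((1 : Matrix a a ℂ) ⊗ₖ σ)) :
    condRenyiEntropyUp β ρ + (x : EReal) ≤ (y : EReal) := by
  have h1 : ((x - y : ℝ) : EReal) ≤ ⨅ σ : {σ : Matrix b b ℂ // IsDensityMatrix σ},
      renyiDivergence β ρ ((1 : Matrix a a ℂ) ⊗ₖ σ.1) := le_iInf fun σ => h σ.1 σ.2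
  have h2 := EReal.neg_le_neg_iff.mpr h1
  refine (add_le_add_left h2 _).trans (le_of_eq ?_)
  norm_cast
  ring

theorem le_condRenyiEntropyUp_add {β : ℝ} {ρ : Matrix (a × b) (a × b) ℂ} {x y : ℝ}
    {σ : Matrix b b ℂ} (hσ : IsDensityMatrix σ)
    (h : renyiDivergence β ρ ((1 : Matrix a a ℂ) ⊗ₖ σ) ≤ ((x - y : ℝ) : EReal)) :
    (y : EReal) ≤ condRenyiEntropyUp β ρ + (x : EReal) := by
  have h1 : (⨅ σ : {σ : Matrix b b ℂ // IsDensityMatrix σ},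
      renyiDivergence β ρ ((1 : Matrix a a ℂ) ⊗ₖ σ.1)) ≤ ((x - y : ℝ) : EReal) :=
    iInf_le_of_le ⟨σ, hσ⟩ h
  have h2 := EReal.neg_le_neg_iff.mpr h1
  refine le_trans (le_of_eq ?_) (add_le_add_left h2 _)
  norm_cast
  ring

/-- The relation between the orders, in terms of their conjugate exponents. -/
theorem one_sub_inv_mul_add_eq {α β γ : ℝ} (hα : α ≠ 0) (hβ : β ≠ 0) (hγ : γ ≠ 0)
    (hrel : α * β * γ - 2 * β * γ - α + β + γ = 0) :
    (1 - 1 / α) * ((1 - 1 / β) + (1 - 1 / γ)) = (1 - 1 / β) * (1 - 1 / γ) := by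
  field_simp
  linear_combination hrel

/-- Convexity of the logarithm of the Schatten norm at the three points of the `(x, 1 / p)`-plane
attached to the three entropies. -/
theorem interpolation_sign {α β γ : ℝ} (hα : 1 / 2 ≤ α) (hβ : 1 / 2 ≤ β) (hγ : 0 < γ)
    (hrel : α * β * γ - 2 * β * γ - α + β + γ = 0)
    {ρ : Matrix (a × b) (a × b) ℂ} (hρ : ρ.PosSemidef) {σ : Matrix b b ℂ} (hσ : σ.PosSemidef)
    (hne : ρ * ((1 : Matrix a a ℂ) ⊗ₖ σ) ≠ 0)
    (hdom : 0 < (1 - 1 / β) * (1 - 1 / γ) → Dominates ((1 : Matrix a a ℂ) ⊗ₖ σ) ρ) :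
    0 ≤ (1 - 1 / β) * (1 - 1 / γ) * ((1 - 1 / β) + (1 - 1 / γ)) *
      ((1 - 1 / γ) * (1 / β *
          Real.logb 2 ((sandwich ((1 : Matrix a a ℂ) ⊗ₖ σ) ρ (1 / β - 1)).tracePow β)) +
        (1 - 1 / β) * Real.logb 2 (partialTraceLeft ρ * matrixPow σ (1 - 1 / γ)).trace.re -
        ((1 - 1 / β) + (1 - 1 / γ)) * (1 / α * Real.logb 2 (ρ.tracePow α))) := by
  have hα0 : 0 < α := by linarith
  have hβ0 : 0 < β := by linarith
  have ht := one_sub_inv_mul_add_eq hα0.ne' hβ0.ne' hγ.ne' hrel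
  have hS := posSemidef_one_kronecker (a := a) hσ
  set S := (1 : Matrix a a ℂ) ⊗ₖ σ with hSdef
  have hc := tracePow_one_sandwich_one_kronecker (a := a) hρ hσ (1 - 1 / γ)
  have ha := sandwich_zero hS.isHermitian ρ
  rw [← hc, ← hSdef]
  have hx : 1 / β - 1 = -(1 - 1 / β) := by ring
  rw [hx]
  set u := 1 - 1 / β with hu
  set v := 1 - 1 / γ with hv
  have hβu : 1 / β = 1 - u := by rw [hu]; ring
  have hαt : (u + v) * (1 / α) = (u + v) - u * v := by linear_combination -ht
  rw [show Real.logb 2 (ρ.tracePow α) = Real.logb 2 ((sandwich S ρ 0).tracePow α) by rw [ha]]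
  rw [show Real.logb 2 ((sandwich S ρ v).tracePow 1) =
    1 / 1 * Real.logb 2 ((sandwich S ρ v).tracePow 1) by rw [div_one, one_mul]]
  have conv := @log_tracePow_sandwich_convex _ _ _ ρ S hρ hS hne
  have h12 : (1 / 2 : ℝ) ≤ 1 := by norm_num
  -- The signs of `u`, `v`, `u + v` determine which of the abscissae `-u`, `0`, `v` is in the
  -- middle. Domination is needed only if it is `0`, that is, if `u * v > 0`. The order at `v` is
  -- `1`, so `γ` needs no bound by `1 / 2`.
  rcases lt_trichotomy u 0 with hu0 | hu0 | hu0
  · rcases lt_trichotomy v 0 with hv0 | hv0 | hv0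
    · have := conv (p := α) (p₀ := 1) (p₁ := β) (x₀ := v) (x₁ := -u) (y := 0) hv0 (by linarith)
        h12 hβ hα0 (by rw [hβu]; linear_combination -hαt) (fun _ => hdom (mul_pos_of_neg_of_neg hu0 hv0))
      have h1 : 0 < u * v := mul_pos_of_neg_of_neg hu0 hv0
      refine mul_nonneg_of_nonpos_of_nonpos (mul_nonpos_of_nonneg_of_nonpos h1.le (by linarith)) ?_
      linarith
    · simp [hv0]
    · have h1 : u * v < 0 := mul_neg_of_neg_of_pos hu0 hv0
      rcases lt_trichotomy (u + v) 0 with h | h | h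
      · have := conv (p := 1) (p₀ := α) (p₁ := β) (x₀ := 0) (x₁ := -u) (y := v) hv0 (by linarith)
          hα hβ one_pos (by rw [hβu]; linear_combination hαt) (fun h => absurd h hv0.ne')
        refine mul_nonneg (mul_pos_of_neg_of_neg h1 h).le ?_
        linarith
      · simp [h]
      · have := conv (p := β) (p₀ := α) (p₁ := 1) (x₀ := 0) (x₁ := v) (y := -u) (by linarith)
          (by linarith) hα h12 hβ0 (by rw [hβu]; linear_combination -hαt) (fun h => by linarith)
        refine mul_nonneg_of_nonpos_of_nonpos (mul_neg_of_neg_of_pos h1 h).le ?_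
        linarith
  · simp [hu0]
  · rcases lt_trichotomy v 0 with hv0 | hv0 | hv0
    · have h1 : u * v < 0 := mul_neg_of_pos_of_neg hu0 hv0
      rcases lt_trichotomy (u + v) 0 with h | h | h
      · have := conv (p := β) (p₀ := 1) (p₁ := α) (x₀ := v) (x₁ := 0) (y := -u) (by linarith)
          (by linarith) h12 hα hβ0 (by rw [hβu]; linear_combination hαt) (fun h => by linarith)
        refine mul_nonneg (mul_pos_of_neg_of_neg h1 h).le ?_
        linarith
      · simp [h]
      · have := conv (p := 1) (p₀ := β) (p₁ := α) (x₀ := -u) (x₁ := 0) (y := v) (by linarith)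
          hv0 hβ hα one_pos (by rw [hβu]; linear_combination -hαt) (fun h => absurd h hv0.ne)
        refine mul_nonneg_of_nonpos_of_nonpos (mul_neg_of_neg_of_pos h1 h).le ?_
        linarith
    · simp [hv0]
    · have := conv (p := α) (p₀ := β) (p₁ := 1) (x₀ := -u) (x₁ := v) (y := 0) (by linarith) hv0
        hβ h12 hα0 (by rw [hβu]; linear_combination hαt) (fun _ => hdom (mul_pos hu0 hv0))
      have h1 : 0 < u * v := mul_pos hu0 hv0
      refine mul_nonneg (mul_pos h1 (by linarith)).le ?_
      linarith

end Divergence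

/-! ### The chain rules and their limiting orders -/

section ChainRule

variable {a b : Type*} [Fintype a] [DecidableEq a] [Fintype b] [DecidableEq b]

theorem eq_one_of_relation_of_eq_one {α β γ : ℝ} (hγ : γ ≠ 1)
    (hrel : α * β * γ - 2 * β * γ - α + β + γ = 0) : (β = 1 → α = 1) ∧ (β ≠ 1 → α ≠ 1) := by
  constructor
  · rintro rfl
    have : (α - 1) * (γ - 1) = 0 := by linear_combination hrel
    rcases mul_eq_zero.mp this with h | h
    · linarith
    · exact absurd (by linarith) hγ
  · rintro hβ rfl
    have : (β - 1) * (γ - 1) = 0 := by linear_combination -hrel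
    rcases mul_eq_zero.mp this with h | h
    · exact hβ (by linarith)
    · exact hγ (by linarith)

/-- If the sum vanishes, the relation forces the product of the summands, which is then `-(1 - 1 /
γ)²`, to vanish as well. Hence the comparison of `1 / β + 1 / γ` with `2` is strict when `γ ≠ 1`. -/
theorem conjugate_add_ne_zero {α β γ : ℝ} (hα : α ≠ 0) (hβ : β ≠ 0) (hγ0 : γ ≠ 0) (hγ : γ ≠ 1)
    (hrel : α * β * γ - 2 * β * γ - α + β + γ = 0) : (1 - 1 / β) + (1 - 1 / γ) ≠ 0 := by
  intro h
  have ht := one_sub_inv_mul_add_eq hα hβ hγ0 hrel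
  rw [h, mul_zero] at ht
  have hv : 1 - 1 / γ = 0 := by
    have h1 : 1 - 1 / β = -(1 - 1 / γ) := by linarith
    rw [h1] at ht
    have : (1 - 1 / γ) * (1 - 1 / γ) = 0 := by linarith
    exact mul_self_eq_zero.mp this
  apply hγ
  field_simp at hv
  linarith

/-- The passage from convexity to entropies: the sign of the linear combination of entropies. -/
theorem entropy_sign {α β γ A B C : ℝ} (hα : 1 / 2 ≤ α) (hβ : 1 / 2 ≤ β) (hγ0 : 0 < γ)
    (hα1 : α ≠ 1) (hβ1 : β ≠ 1) (hγ1 : γ ≠ 1)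
    (hrel : α * β * γ - 2 * β * γ - α + β + γ = 0)
    (h : 0 ≤ (1 - 1 / β) * (1 - 1 / γ) * ((1 - 1 / β) + (1 - 1 / γ)) *
      ((1 - 1 / γ) * (1 / β * B) + (1 - 1 / β) * C -
        ((1 - 1 / β) + (1 - 1 / γ)) * (1 / α * A))) :
    0 ≤ ((1 - 1 / β) + (1 - 1 / γ)) *
      (1 / (β - 1) * B + 1 / (1 - 1 / γ) * C + 1 / (1 - α) * A) := by
  have hα0 : 0 < α := by linarith
  have hβ0 : 0 < β := by linarith
  have ht := one_sub_inv_mul_add_eq hα0.ne' hβ0.ne' hγ0.ne' hrel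
  have hu0 : 1 - 1 / β ≠ 0 := fun h => hβ1 (by field_simp at h; linarith)
  have hv0 : 1 - 1 / γ ≠ 0 := fun h => hγ1 (by field_simp at h; linarith)
  have ht0 : 1 - 1 / α ≠ 0 := fun h => hα1 (by field_simp at h; linarith)
  have hB : 1 / (β - 1) = 1 / (1 - 1 / β) * (1 / β) := by
    have : β - 1 ≠ 0 := sub_ne_zero.2 hβ1
    rw [show 1 - 1 / β = (β - 1) / β by field_simp]
    field_simp
  have hA : 1 / (1 - α) = -(1 / (1 - 1 / α)) * (1 / α) := by
    have h1 : α - 1 ≠ 0 := sub_ne_zero.2 hα1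
    have h2 : 1 - α ≠ 0 := sub_ne_zero.2 hα1.symm
    rw [show 1 - 1 / α = (α - 1) / α by field_simp]
    field_simp
    ring
  rw [hA, hB]
  set u := 1 - 1 / β
  set v := 1 - 1 / γ
  set t := 1 - 1 / α
  have huv : u * v ≠ 0 := mul_ne_zero hu0 hv0
  have hinv : 1 / t = (u + v) / (u * v) := by
    rw [div_eq_div_iff ht0 huv]
    linear_combination -ht
  -- The symmetric prefactor `u v (u + v)` becomes `u + v` after division by the positive square `(u
  -- v)²`.
  have e : (u + v) * (1 / u * (1 / β) * B + 1 / v * C + -(1 / t) * (1 / α) * A) =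
      (u * v * (u + v) * (v * (1 / β * B) + u * C - (u + v) * (1 / α * A))) / (u * v) ^ 2 := by
    rw [hinv]
    generalize 1 / β = β'
    generalize 1 / α = α'
    field_simp
    ring
  rw [e]
  positivity

theorem renyiEntropy_eq_conjugate {γ : ℝ} (hγ0 : 0 < γ) (hγ1 : γ ≠ 1) {τ : Matrix b b ℂ}
    (hτ : IsDensityMatrix τ) :
    renyiEntropy γ τ = -(1 / (1 - 1 / γ) * Real.logb 2 (τ.tracePow γ ^ (1 / γ))) := by
  rw [renyiEntropy_of_ne hγ0.ne' hγ1, Real.logb_rpow_eq_mul_logb_of_pos (hτ.tracePow_pos γ)]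
  have h1 : γ - 1 ≠ 0 := sub_ne_zero.2 hγ1
  have h2 : 1 - γ ≠ 0 := sub_ne_zero.2 hγ1.symm
  rw [show 1 - 1 / γ = (γ - 1) / γ by field_simp]
  field_simp
  ring

/-- The variational bound of the entropy of `τ` by the moments of a state `σ`. -/
theorem logb_re_trace_mul_matrixPow_le {γ : ℝ} (hγ0 : 0 < γ) (hγ1 : γ ≠ 1) {τ σ : Matrix b b ℂ}
    (hτ : IsDensityMatrix τ) (hσ : IsDensityMatrix σ)
    (hpos : 0 < (τ * matrixPow σ (1 - 1 / γ)).trace.re) (hdom : γ < 1 → Dominates σ τ) :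
    1 / (1 - 1 / γ) * Real.logb 2 (τ * matrixPow σ (1 - 1 / γ)).trace.re ≤ -renyiEntropy γ τ := by
  rw [renyiEntropy_eq_conjugate hγ0 hγ1 hτ, neg_neg]
  -- Hölder reverses direction at `γ = 1`, and so does the sign of `1 - 1 / γ`; the two reversals
  -- cancel.
  rcases lt_or_gt_of_ne hγ1 with hγ | hγ
  · have hv : 1 - 1 / γ < 0 := by
      rw [sub_neg, lt_div_iff₀ hγ0]
      linarith
    exact mul_le_mul_of_nonpos_left (Real.logb_le_logb_of_le one_lt_two
      (Real.rpow_pos_of_pos (hτ.tracePow_pos γ) _)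
      (le_re_trace_mul_matrixPow hτ hσ (hdom hγ) hγ0 hγ)) (one_div_neg.2 hv).le
  · have hv : 0 < 1 - 1 / γ := by
      rw [sub_pos, div_lt_iff₀ hγ0]
      linarith
    exact mul_le_mul_of_nonneg_left (Real.logb_le_logb_of_le one_lt_two hpos
      (re_trace_mul_matrixPow_le hτ hσ hγ)) (one_div_pos.2 hv).le

theorem re_trace_mul_matrixPow_pos {ρ : Matrix (a × b) (a × b) ℂ} (hρ : ρ.PosSemidef)
    {σ : Matrix b b ℂ} (hσ : σ.PosSemidef) (hne : ρ * ((1 : Matrix a a ℂ) ⊗ₖ σ) ≠ 0) (v : ℝ) :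
    0 < (partialTraceLeft ρ * matrixPow σ v).trace.re := by
  rw [← tracePow_one_sandwich_one_kronecker hρ hσ]
  exact (hρ.sandwich _ v).tracePow_pos
    (sandwich_ne_zero hρ (posSemidef_one_kronecker hσ) hne v) 1

theorem condRenyiEntropyUp_add_le_of_ne_one {α β γ : ℝ} (hα : 1 / 2 ≤ α) (hβ : 1 / 2 ≤ β)
    (hγ0 : 0 < γ) (hγ1 : γ ≠ 1) (hrel : α * β * γ - 2 * β * γ - α + β + γ = 0)
    {ρ : Matrix (a × b) (a × b) ℂ} (hρ : IsDensityMatrix ρ) (h2 : 1 / β + 1 / γ ≤ 2) :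
    condRenyiEntropyUp β ρ + (renyiEntropy γ (partialTraceLeft ρ) : EReal)
        ≤ (renyiEntropy α ρ : EReal) := by
  have hα0 : 0 < α := by linarith
  have hβ0 : 0 < β := by linarith
  have hρB := isDensityMatrix_partialTraceLeft hρ
  have hα1 := eq_one_of_relation_of_eq_one hγ1 hrel
  have huv : 0 < (1 - 1 / β) + (1 - 1 / γ) := lt_of_le_of_ne (by linarith)
    (conjugate_add_ne_zero hα0.ne' hβ0.ne' hγ0.ne' hγ1 hrel).symm
  refine condRenyiEntropyUp_add_le fun σ hσ => ?_
  have hS := posSemidef_one_kronecker (a := a) hσ.posSemidef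
  by_cases hβ1 : β = 1
  · subst hβ1
    rw [hα1.1 rfl]
    by_cases hD : Dominates ((1 : Matrix a a ℂ) ⊗ₖ σ) ρ
    · have hv : 0 < 1 - 1 / γ := by simpa using huv
      have hne := hD.mul_ne_zero hρ.posSemidef hS hρ.ne_zero
      rw [renyiDivergence_one_one_kronecker hσ.posSemidef.isHermitian hD, EReal.coe_le_coe_iff]
      have h3 := logb_re_trace_mul_matrixPow_le hγ0 hγ1 hρB hσ
        (re_trace_mul_matrixPow_pos hρ.posSemidef hσ.posSemidef hne _)
        (fun _ => hD.partialTraceLeft)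
      have h4 := mul_le_mul_of_nonneg_left
        (mul_re_trace_mul_matrixLog_le hρB hσ hD.partialTraceLeft (1 - 1 / γ))
        (one_div_pos.2 hv).le
      rw [← mul_assoc, one_div_mul_cancel hv.ne', one_mul] at h4
      linarith
    · rw [renyiDivergence, if_pos rfl, if_neg hD]
      exact le_top
  · by_cases hD : ρ * ((1 : Matrix a a ℂ) ⊗ₖ σ) ≠ 0 ∧
        (Dominates ((1 : Matrix a a ℂ) ⊗ₖ σ) ρ ∨ β < 1)
    · rw [renyiDivergence_of_ne_one hβ0 hβ1 hD.1 hD.2, EReal.coe_le_coe_iff]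
      -- For `β > 1`, finiteness of the divergence gives domination. Since the conjugate terms have
      -- positive sum, both uses below (`γ < 1`, or a positive product) force `β > 1`.
      have hdom : 0 < 1 - 1 / β → Dominates ((1 : Matrix a a ℂ) ⊗ₖ σ) ρ := fun hu =>
        hD.2.resolve_right fun h => by
          rw [sub_pos, div_lt_iff₀ hβ0] at hu
          linarith
      have h3 := logb_re_trace_mul_matrixPow_le hγ0 hγ1 hρB hσ
        (re_trace_mul_matrixPow_pos hρ.posSemidef hσ.posSemidef hD.1 _)
        (fun hγ => (hdom (by
          have : 1 < 1 / γ := by rwa [lt_div_iff₀ hγ0, one_mul]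
          linarith)).partialTraceLeft)
      have h4 := entropy_sign hα hβ hγ0 (hα1.2 hβ1) hβ1 hγ1 hrel
        (interpolation_sign hα hβ hγ0 hrel hρ.posSemidef hσ.posSemidef hD.1 fun h => hdom (by
          by_contra hu
          rw [not_lt] at hu
          have : 0 < 1 - 1 / γ := by linarith
          linarith [mul_nonpos_of_nonpos_of_nonneg hu this.le]))
      have h5 := nonneg_of_mul_nonneg_right h4 huv
      rw [← renyiEntropy_of_ne hα0.ne' (hα1.2 hβ1)] at h5
      linarith
    · rw [renyiDivergence, if_neg hβ1, if_neg hD]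
      exact le_top

/-- One witness suffices for the infimum: the tilted marginal attains equality in the variational
bound, and it has full enough support for domination to be automatic. -/
theorem le_condRenyiEntropyUp_add_of_ne_one {α β γ : ℝ} (hα : 1 / 2 ≤ α) (hβ : 1 / 2 ≤ β)
    (hγ0 : 0 < γ) (hγ1 : γ ≠ 1) (hrel : α * β * γ - 2 * β * γ - α + β + γ = 0)
    {ρ : Matrix (a × b) (a × b) ℂ} (hρ : IsDensityMatrix ρ) (h2 : 2 ≤ 1 / β + 1 / γ) :
    (renyiEntropy α ρ : EReal) ≤
      condRenyiEntropyUp β ρ + (renyiEntropy γ (partialTraceLeft ρ) : EReal) := by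
  have hα0 : 0 < α := by linarith
  have hβ0 : 0 < β := by linarith
  have hρB := isDensityMatrix_partialTraceLeft hρ
  have hα1 := eq_one_of_relation_of_eq_one hγ1 hrel
  have huv : (1 - 1 / β) + (1 - 1 / γ) < 0 := lt_of_le_of_ne (by linarith)
    (conjugate_add_ne_zero hα0.ne' hβ0.ne' hγ0.ne' hγ1 hrel)
  have hσ := isDensityMatrix_tilted hρB γ
  refine le_condRenyiEntropyUp_add hσ ?_
  set σ := tilted (partialTraceLeft ρ) γ with hσdef
  have hS := posSemidef_one_kronecker (a := a) hσ.posSemidef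
  have hD' : Dominates σ (partialTraceLeft ρ) := dominates_tilted hρB γ
  have hD : Dominates ((1 : Matrix a a ℂ) ⊗ₖ σ) ρ :=
    Dominates.of_partialTraceLeft hρ.posSemidef hσ.posSemidef hD'
  have hne := hD.mul_ne_zero hρ.posSemidef hS hρ.ne_zero
  have h3 : 1 / (1 - 1 / γ) *
      Real.logb 2 (partialTraceLeft ρ * matrixPow σ (1 - 1 / γ)).trace.re =
      -renyiEntropy γ (partialTraceLeft ρ) := by
    rw [renyiEntropy_eq_conjugate hγ0 hγ1 hρB, re_trace_mul_matrixPow_tilted hρB hγ0.ne', neg_neg]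
  by_cases hβ1 : β = 1
  · subst hβ1
    rw [hα1.1 rfl, renyiDivergence_one_one_kronecker hσ.posSemidef.isHermitian hD,
      EReal.coe_le_coe_iff]
    have hv : 1 - 1 / γ < 0 := by simpa using huv
    have h4 := mul_le_mul_of_nonpos_left
      (mul_re_trace_mul_matrixLog_le hρB hσ hD' (1 - 1 / γ)) (one_div_neg.2 hv).le
    rw [← mul_assoc, one_div_mul_cancel hv.ne, one_mul] at h4
    linarith
  · rw [renyiDivergence_of_ne_one hβ0 hβ1 hne (.inl hD), EReal.coe_le_coe_iff]
    have h4 := entropy_sign hα hβ hγ0 (hα1.2 hβ1) hβ1 hγ1 hrel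
      (interpolation_sign hα hβ hγ0 hrel hρ.posSemidef hσ.posSemidef hne fun _ => hD)
    have h5 := nonpos_of_mul_nonneg_right h4 huv
    rw [← renyiEntropy_of_ne hα0.ne' (hα1.2 hβ1)] at h5
    linarith

/-- Addition on `EReal` is continuous here even for infinite `C`, because the other summand stays
finite. -/
theorem tendsto_ereal_add_coe {l : Filter ℝ} {f : ℝ → ℝ} {x : ℝ} (C : EReal)
    (hf : Tendsto f l (𝓝 x)) : Tendsto (fun t => C + (f t : EReal)) l (𝓝 (C + (x : EReal))) := by
  have h := EReal.continuousAt_add (p := (C, (x : EReal))) (.inr (EReal.coe_ne_bot x))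
    (.inr (EReal.coe_ne_top x))
  exact h.tendsto.comp (tendsto_const_nhds.prodMk_nhds
    ((continuous_coe_real_ereal.tendsto x).comp hf))

/-- The order `α` determined by the orders `β` and `γ`. -/
noncomputable def relatedOrder (β γ : ℝ) : ℝ := (2 * β * γ - β - γ) / (β * γ - 1)

theorem relatedOrder_relation {β γ : ℝ} (h : β * γ - 1 ≠ 0) :
    relatedOrder β γ * β * γ - 2 * β * γ - relatedOrder β γ + β + γ = 0 := by
  have : relatedOrder β γ * (β * γ - 1) = 2 * β * γ - β - γ := div_mul_cancel₀ _ h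
  linear_combination this

theorem continuousAt_relatedOrder {β γ : ℝ} (h : β * γ - 1 ≠ 0) :
    ContinuousAt (relatedOrder β) γ :=
  ContinuousAt.div (by fun_prop) (by fun_prop) h

/-- For `β = 1` numerator and denominator are both `γ - 1`, so the quotient is `1` off `γ = 1`. The
limit selects `α = 1` in the degenerate case, where the relation leaves `α` free. -/
theorem tendsto_relatedOrder_one (β : ℝ) : Tendsto (relatedOrder β) (𝓝[≠] 1) (𝓝 1) := by
  rcases eq_or_ne β 1 with rfl | hβ
  · refine tendsto_const_nhds.congr' ?_
    filter_upwards [self_mem_nhdsWithin] with γ hγ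
    have h : γ - 1 ≠ 0 := sub_ne_zero.2 hγ
    rw [relatedOrder, show 2 * 1 * γ - 1 - γ = γ - 1 by ring, one_mul, div_self h]
  · have h : β * 1 - 1 ≠ 0 := by
      rw [mul_one]
      exact sub_ne_zero.2 hβ
    have := (continuousAt_relatedOrder h).tendsto
    rw [show relatedOrder β 1 = 1 by
      rw [relatedOrder, div_eq_one_iff_eq h]
      ring] at this
    exact this.mono_left nhdsWithin_le_nhds

end ChainRule

/-- Since `1 / 0 = 0`, the condition `0 < γ` and the alternative `γ = 0` encode the reading `1 / γ =
+∞` at `γ = 0`. -/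
theorem theorem3p3 {a b : Type*} [Fintype a] [DecidableEq a] [Fintype b] [DecidableEq b]
    (α β γ : ℝ) (hα : 1 / 2 ≤ α) (hβ : 1 / 2 ≤ β) (hγ : 0 ≤ γ)
    (hrel : α * β * γ - 2 * β * γ - α + β + γ = 0)
    (hdeg : β = 1 → γ = 1 → α = 1)
    (ρ : Matrix (a × b) (a × b) ℂ) (hρ : IsDensityMatrix ρ) :
    (0 < γ → 1 / β + 1 / γ ≤ 2 →
      condRenyiEntropyUp β ρ + (renyiEntropy γ (partialTraceLeft ρ) : EReal)
        ≤ (renyiEntropy α ρ : EReal)) ∧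
    (γ = 0 ∨ 2 ≤ 1 / β + 1 / γ →
      (renyiEntropy α ρ : EReal)
        ≤ condRenyiEntropyUp β ρ + (renyiEntropy γ (partialTraceLeft ρ) : EReal)) := by
  have hρB := isDensityMatrix_partialTraceLeft hρ
  have hβ0 : 0 < β := by linarith
  have hα_of : γ = 1 → α = 1 := by
    rintro rfl
    have : (α - 1) * (β - 1) = 0 := by linear_combination hrel
    rcases mul_eq_zero.mp this with h | h
    · linarith
    · exact hdeg (by linarith) rfl
  have hlim : ∀ l : Filter ℝ, Tendsto (relatedOrder β) l (𝓝 α) →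
      Tendsto (fun x => (renyiEntropy (relatedOrder β x) ρ : EReal)) l
        (𝓝 (renyiEntropy α ρ : EReal)) := fun l h =>
    (continuous_coe_real_ereal.tendsto _).comp
      ((continuousAt_renyiEntropy hρ (by linarith)).tendsto.comp h)
  have hlimB : γ = 1 → ∀ l : Filter ℝ, l ≤ 𝓝 1 →
      Tendsto (fun x => condRenyiEntropyUp β ρ + (renyiEntropy x (partialTraceLeft ρ) : EReal)) l
        (𝓝 (condRenyiEntropyUp β ρ + (renyiEntropy γ (partialTraceLeft ρ) : EReal))) := by
    rintro rfl l hl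
    exact tendsto_ereal_add_coe _ ((continuousAt_renyiEntropy hρB one_pos).tendsto.mono_left hl)
  have hhalf : ∀ᶠ x in 𝓝[≠] (1 : ℝ), 1 / 2 ≤ relatedOrder β x :=
    (tendsto_relatedOrder_one β).eventually (eventually_ge_nhds (by norm_num))
  constructor
  · intro hγ0 h2
    rcases ne_or_eq γ 1 with hγ1 | hγ1
    · exact condRenyiEntropyUp_add_le_of_ne_one hα hβ hγ0 hγ1 hrel hρ h2
    have hβ1 : 1 ≤ β := by
      have : 1 / β ≤ 1 := by
        rw [hγ1] at h2
        linarith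
      rwa [div_le_one hβ0] at this
    -- Here `β ≥ 1`, so approaching `γ = 1` from above preserves `1 / β + 1 / γ ≤ 2`.
    have hle : (𝓝[>] (1 : ℝ)) ≤ 𝓝[≠] 1 := nhdsWithin_mono _ fun x hx => ne_of_gt hx
    refine le_of_tendsto_of_tendsto (hlimB hγ1 (𝓝[>] 1) nhdsWithin_le_nhds)
      (hlim (𝓝[>] 1) (by rw [hα_of hγ1]; exact (tendsto_relatedOrder_one β).mono_left hle)) ?_
    filter_upwards [self_mem_nhdsWithin, hle hhalf] with x hx hx2
    have hx1 : 1 < x := hx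
    have hβx : β * x - 1 ≠ 0 := by nlinarith
    refine condRenyiEntropyUp_add_le_of_ne_one hx2 hβ (by linarith) hx1.ne'
      (relatedOrder_relation hβx) hρ ?_
    have h3 : 1 / β ≤ 1 := by rwa [div_le_one hβ0]
    have h4 : 1 / x ≤ 1 := by
      rw [div_le_one (by linarith)]
      exact hx1.le
    linarith
  · intro h2
    rcases hγ.eq_or_lt with rfl | hγ0
    · have hαβ : α = β := by linarith
      have h0 : β * 0 - 1 ≠ 0 := by norm_num
      have ht : Tendsto (relatedOrder β) (𝓝[>] 0) (𝓝 α) := by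
        have := (continuousAt_relatedOrder h0).tendsto
        rw [show relatedOrder β 0 = α by rw [relatedOrder, hαβ]; ring] at this
        exact this.mono_left nhdsWithin_le_nhds
      refine le_of_tendsto_of_tendsto (hlim (𝓝[>] 0) ht)
        (tendsto_ereal_add_coe _ (tendsto_renyiEntropy_zero hρB)) ?_
      have hsmall : ∀ᶠ x in 𝓝[>] (0 : ℝ), x < 1 / 2 ∧ β * x < 1 := by
        refine nhdsWithin_le_nhds ((eventually_lt_nhds (by norm_num)).and ?_)
        have : ContinuousAt (fun x : ℝ => β * x) 0 := by fun_prop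
        exact this.eventually_lt_const (by norm_num)
      filter_upwards [self_mem_nhdsWithin, hsmall] with x hx hx2
      have hx0 : 0 < x := hx
      have hβx : β * x - 1 < 0 := by linarith [hx2.2]
      refine le_condRenyiEntropyUp_add_of_ne_one ?_ hβ hx0 (by linarith [hx2.1])
        (relatedOrder_relation hβx.ne) hρ ?_
      -- The related order is at least `β`: after clearing the negative denominator this reads `0 ≤
      -- x (β - 1)²`.
      · refine hβ.trans ?_
        rw [relatedOrder, le_div_iff_of_neg hβx]
        nlinarith [mul_nonneg hx0.le (sq_nonneg (β - 1))]
      · have h3 : 2 ≤ 1 / x := by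
          rw [le_div_iff₀ hx0]
          linarith [hx2.1]
        have h4 : 0 < 1 / β := by positivity
        linarith
    have h2 : 2 ≤ 1 / β + 1 / γ := h2.resolve_left hγ0.ne'
    rcases ne_or_eq γ 1 with hγ1 | hγ1
    · exact le_condRenyiEntropyUp_add_of_ne_one hα hβ hγ0 hγ1 hrel hρ h2
    have hβ1 : β ≤ 1 := by
      have : 1 ≤ 1 / β := by
        rw [hγ1] at h2
        linarith
      rwa [le_div_iff₀ hβ0, one_mul] at this
    -- Now `β ≤ 1`, so the approach is from below.
    have hle : (𝓝[<] (1 : ℝ)) ≤ 𝓝[≠] 1 := nhdsWithin_mono _ fun x hx => ne_of_lt hx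
    refine le_of_tendsto_of_tendsto
      (hlim (𝓝[<] 1) (by rw [hα_of hγ1]; exact (tendsto_relatedOrder_one β).mono_left hle))
      (hlimB hγ1 (𝓝[<] 1) nhdsWithin_le_nhds) ?_
    filter_upwards [self_mem_nhdsWithin, hle hhalf,
      nhdsWithin_le_nhds (eventually_gt_nhds (zero_lt_one (α := ℝ)))] with x hx hx2 hx0
    have hx1 : x < 1 := hx
    have hβx : β * x - 1 ≠ 0 := by nlinarith
    refine le_condRenyiEntropyUp_add_of_ne_one hx2 hβ hx0 hx1.ne
      (relatedOrder_relation hβx) hρ ?_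
    have h3 : 1 ≤ 1 / β := by rwa [le_div_iff₀ hβ0, one_mul]
    have h4 : 1 ≤ 1 / x := by
      rw [le_div_iff₀ hx0]
      linarith
    linarith
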